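/- Let $D\subset\mathbb{R}^3$ be an open convex set with non-empty boundary. Let $b$ be its extended distance, $b(x)=d(x,D^c)$ for $x\in D$ and $b(x)=-d(x,D)$ for $x\notin D$. Let $G$ be the Dirichlet Green function of $D$, normalised by $\Delta_xG(\cdot,y)=\delta_y$: for each $y\in D$, $G(\cdot,y)+\frac{1}{4\pi|\cdot-y|}$ extends to a harmonic function on $D$, $G(x,y)\to0$ as $x\in D$ tends to a point of $\partial D$, and $G(x,y)\to 0$ as $|x|\to\infty$ in $D$. Let $0<\alpha\le1$ and assume that $D$ is a (uniformly) $C^{2,\alpha}$ domain: there are $r>0$ and $K$ such that for each $p\in\partial D$, after a rigid motion taking $p$ to $0$, $D\cap B(p,r)$ is the part of $B(p,r)$ strictly above the graph of a function $w$ that is $C^2$ on $\{v\in\mathbb{R}^2:|v|<r\}$ with $w(0)=0$, $\nabla w(0)=0$, $|\nabla^2w(v)|\le K$ and $|\nabla^2w(v)-\nabla^2w(v')|\le K|v-v'|^\alpha$. Assume also that there is a constant $A$ with $$|x-y|^3\big[|\nabla_x^2G(x,y)|+|\nabla_y^2G(x,y)|\big]\le A\qquad\text{for all }x\ne y\text{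 in }D.$$ Then there is a constant $C>0$ such that for all $L\ge1$ and all $x\in D$ with $b(x)\le1$ at which $b$ is differentiable, the function $y\mapsto[\nabla_xb(x)\cdot\nabla_xG(x,y)]_+$ belongs to $L^1(D\cap\{|x-y|\le L\})$ and to $L^\infty(D\cap\{|x-y|\ge L\})$, and $$\big\|[\nabla_xb(x)\cdot\nabla_xG(x,y)]_+\big\|_{L^1_y(D\cap\{|x-y|\le L\})}\le C\,b(x)\ln(L+1),$$ $$\big\|[\nabla_xb(x)\cdot\nabla_xG(x,y)]_+\big\|_{L^\infty_y(D\cap\{|x-y|\ge L\})}\le C\,b(x)L^{-3}.$$ -/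

import Mathlib

open Filter Topology MeasureTheory

/-- Three-dimensional Euclidean space. -/
abbrev E3 : Type := EuclideanSpace ℝ (Fin 3)

/-- The plane over which the boundary is locally a graph. -/
abbrev E2 : Type := EuclideanSpace ℝ (Fin 2)

open Classical in
/-- The extended (signed) distance to the boundary: `b(x) = d(x, Dᶜ)` for `x ∈ D` and
`b(x) = -d(x, D)` for `x ∉ D`. -/
noncomputable def extendedDist (D : Set E3) (x : E3) : ℝ :=
  if x ∈ D then Metric.infDist x Dᶜ else -Metric.infDist x D

/-- `G` is the Dirichlet Green function of the Laplacian on `D`, normalised by `Δ_x G(·, y) = δ_y`: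
for every pole `y ∈ D`, the function `G(·, y)` differs on `D \ {y}` from the fundamental solution
`-1 / (4π|x - y|)` by a harmonic function on `D`, and tends to `0` at the boundary and at infinity.
Only the values on `D × D` off the diagonal matter, and there these conditions determine `G` by the
maximum principle. -/
structure IsDirichletGreenFunction (D : Set E3) (G : E3 → E3 → ℝ) : Prop where
  harmonic_part : ∀ y ∈ D, ∃ h : E3 → ℝ, InnerProductSpace.HarmonicOnNhd h D ∧
    ∀ x ∈ D, x ≠ y → G x y = -(1 / (4 * Real.pi * ‖x - y‖)) + h x
  boundary : ∀ y ∈ D, ∀ z ∈ frontier D, Tendsto (fun x => G x y) (𝓝[D] z) (𝓝 0)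
  infinity : ∀ y ∈ D, Tendsto (fun x => G x y) (Bornology.cobounded E3 ⊓ 𝓟 D) (𝓝 0)

/-- `D` is a (uniformly) `C^{2,α}` domain: there are a radius `r > 0` and a bound `K` such that
around each boundary point `p`, after a rigid motion sending `p` to `0`, the set `D ∩ B(p, r)` is
the part of `B(p, r)` strictly above the graph of a `C^{2,α}` function `w` with `w(0) = 0`,
`∇w(0) = 0`, whose second derivatives are bounded by `K` with `α`-Hölder seminorm at most `K`. -/
def IsC2HolderDomain (α : ℝ) (D : Set E3) : Prop :=
  ∃ r : ℝ, 0 < r ∧ ∃ K : ℝ, ∀ p ∈ frontier D,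
    ∃ (e : E3 ≃ₗᵢ[ℝ] WithLp 2 (E2 × ℝ)) (w : E2 → ℝ),
      ContDiffOn ℝ 2 w (Metric.ball 0 r) ∧ w 0 = 0 ∧ fderiv ℝ w 0 = 0 ∧
      (∀ v ∈ Metric.ball (0 : E2) r, ‖iteratedFDeriv ℝ 2 w v‖ ≤ K) ∧
      (∀ v ∈ Metric.ball (0 : E2) r, ∀ v' ∈ Metric.ball (0 : E2) r,
        ‖iteratedFDeriv ℝ 2 w v - iteratedFDeriv ℝ 2 w v'‖ ≤ K * ‖v - v'‖ ^ α) ∧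
      ∀ x ∈ Metric.ball p r, (x ∈ D ↔ w (e (x - p)).fst < (e (x - p)).snd)

/-- The bound `|x - y|³ (|∇_x² G(x,y)| + |∇_y² G(x,y)|) ≲ 1` on `D × D` off the diagonal. -/
def GreenHessianBound (D : Set E3) (G : E3 → E3 → ℝ) : Prop :=
  ∃ A : ℝ, ∀ x ∈ D, ∀ y ∈ D, x ≠ y →
    ‖x - y‖ ^ 3 * (‖iteratedFDeriv ℝ 2 (fun z => G z y) x‖ +
      ‖iteratedFDeriv ℝ 2 (fun z => G x z) y‖) ≤ A

/-- The positive part `[∇b(x) · ∇_x G(x, y)]₊`. -/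
noncomputable def normalDerivPos (D : Set E3) (G : E3 → E3 → ℝ) (x y : E3) : ℝ :=
  max (inner ℝ (gradient (extendedDist D) x) (gradient (fun z => G z y) x)) 0

/-! Write `x = p + b n`, where `p` is a nearest boundary point, so that `n = ∇b(x)` and `b = b(x)`.
Three pointwise bounds for the positive part of `n · ∇_x G(x, y)` are enough
(`exists_normalDerivPos_bounds`). It is `O(|x - y|⁻²)` for `|x - y| ≤ 13 b`; it vanishes for `13 b ≤
|x - y| ≤ ε`, with `ε` depending only on the interior ball radius of `D`; and it is always `O(b |x -
y|⁻³)`. Integration in polar coordinates gives `O(b)` from the first region and `O(b ln(L/ε))` from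
the shell `ε < |x - y| ≤ L`; the third bound also gives the supremum estimate.

The first bound is the interior gradient estimate. The third comes from the Hessian hypothesis:
`G(·, y)` is nonpositive and vanishes at `p`, so along the normal segment from `p` to `x` its slope
at `x` is at most `b` times the supremum of the second derivative.

The vanishing is the heart of the proof (`greenSlope_nonpos`). As a function of the pole `y`, the
slope is harmonic on `D` minus `x`, vanishes on the boundary and decays at infinity. Convexity puts
`D` in the half-space bounded by the tangent plane at `p`. The maximum principle compares the slope
with that of this half-space, whose image charge sits at `p - b n`; the boundary of `D` leaves its
tangent plane only quadratically, which costs an error of size `1 / (r |x - y|)` (`greenSlope_le`).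
The half-space slope is negative, proportionally to the height of `y`, so it absorbs the error
unless `y` is very near the boundary. There a second comparison, with a harmonic quadratic
polynomial in a thin region around the boundary point nearest to `y`, carries the sign down to the
boundary.

Harmonicity in `y` is obtained without symmetry of `G`. The regular part depends on `y` only through
its boundary data `1/|z - y|`, whose discrete Laplacian in `y` tends to `0` uniformly in `z`; the
maximum principle and the gradient estimate pass this on to the slope. Hence the weak notion
`DiffHarmonicAt`, which requires no second derivatives in `y` and still supports a maximum
principle. -/

/-! ### Harmonicity through discrete Laplacians. -/

/-- The centred second difference quotient of `f` at `y` with step `h`, summed over the directions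
of an orthonormal basis: a discrete Laplacian. -/
noncomputable def diffLaplacian (b : OrthonormalBasis (Fin 3) ℝ E3) (h : ℝ) (f : E3 → ℝ)
    (y : E3) : ℝ :=
  ∑ i, (f (y + h • b i) + f (y - h • b i) - 2 * f y) / h ^ 2

/-- A weak form of harmonicity: the discrete Laplacians of `f` at `y` tend to `0` with the step. -/
def DiffHarmonicAt (f : E3 → ℝ) (y : E3) : Prop :=
  ∀ b : OrthonormalBasis (Fin 3) ℝ E3, Tendsto (fun h => diffLaplacian b h f y) (𝓝[>] 0) (𝓝 0)

theorem diffLaplacian_add (b : OrthonormalBasis (Fin 3) ℝ E3) (h : ℝ) (f g : E3 → ℝ) (y : E3) :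
    diffLaplacian b h (fun y => f y + g y) y = diffLaplacian b h f y + diffLaplacian b h g y := by
  simp only [diffLaplacian, ← Finset.sum_add_distrib]
  exact Finset.sum_congr rfl fun i _ => by ring

theorem diffLaplacian_const_mul (b : OrthonormalBasis (Fin 3) ℝ E3) (h c : ℝ) (f : E3 → ℝ)
    (y : E3) : diffLaplacian b h (fun y => c * f y) y = c * diffLaplacian b h f y := by
  simp only [diffLaplacian, Finset.mul_sum]
  exact Finset.sum_congr rfl fun i _ => by ring

theorem DiffHarmonicAt.add {f g : E3 → ℝ} {y : E3} (hf : DiffHarmonicAt f y)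
    (hg : DiffHarmonicAt g y) : DiffHarmonicAt (fun y => f y + g y) y := fun b => by
  simpa [diffLaplacian_add] using (hf b).add (hg b)

theorem DiffHarmonicAt.const_mul {f : E3 → ℝ} {y : E3} (hf : DiffHarmonicAt f y) (c : ℝ) :
    DiffHarmonicAt (fun y => c * f y) y := fun b => by
  simpa [diffLaplacian_const_mul] using (hf b).const_mul c

theorem DiffHarmonicAt.sub {f g : E3 → ℝ} {y : E3} (hf : DiffHarmonicAt f y)
    (hg : DiffHarmonicAt g y) : DiffHarmonicAt (fun y => f y - g y) y := by
  simpa [sub_eq_add_neg] using hf.add (hg.const_mul (-1))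

theorem diffHarmonicAt_const (c : ℝ) (y : E3) : DiffHarmonicAt (fun _ => c) y := fun b => by
  have : (fun h => diffLaplacian b h (fun _ => c) y) = fun _ => 0 := by
    ext h
    exact Finset.sum_eq_zero fun i _ => by ring
  rw [this]; exact tendsto_const_nhds

/-- The second centred difference quotient converges to the second derivative. -/
theorem tendsto_second_diff_quotient {g g' : ℝ → ℝ} {c : ℝ}
    (hg : ∀ᶠ t in 𝓝 0, HasDerivAt g (g' t) t) (hg' : HasDerivAt g' c 0) :
    Tendsto (fun h => (g h + g (-h) - 2 * g 0) / h ^ 2) (𝓝[>] 0) (𝓝 c) := by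
  have hneg : Tendsto (fun h : ℝ => -h) (𝓝 0) (𝓝 0) := by simpa using (continuous_neg (G := ℝ)).tendsto 0
  have hg2 := hneg.eventually hg
  have hc0 : ContinuousAt g 0 := hg.self_of_nhds.continuousAt
  -- After one use of l'Hôpital's rule the quotient is the mean of two slopes of `g'` at `0`, so
  -- `g'` need be differentiable only at that point.
  refine HasDerivAt.lhopital_zero_nhdsGT (f' := fun t => g' t - g' (-t)) (g' := fun t => 2 * t)
    ?_ ?_ ?_ ?_ ?_ ?_
  · filter_upwards [hg.filter_mono nhdsWithin_le_nhds, hg2.filter_mono nhdsWithin_le_nhds]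
      with t h1 h2
    have := (h1.add (h2.scomp t (hasDerivAt_neg t))).sub_const (2 * g 0)
    simpa [Function.comp_def, sub_eq_add_neg] using this
  · filter_upwards with t
    simpa using hasDerivAt_pow 2 t
  · filter_upwards [self_mem_nhdsWithin] with t ht
    have : (0 : ℝ) < t := ht
    positivity
  · have h2 : Tendsto (fun t => g (-t)) (𝓝 0) (𝓝 (g 0)) := hc0.tendsto.comp hneg
    have := (hc0.tendsto.add h2).sub_const (2 * g 0)
    rw [show g 0 + g 0 - 2 * g 0 = 0 by ring] at this
    exact this.mono_left nhdsWithin_le_nhds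
  · have : Tendsto (fun t : ℝ => t ^ 2) (𝓝 0) (𝓝 0) := by
      simpa using (continuous_pow (M := ℝ) 2).tendsto 0
    exact this.mono_left nhdsWithin_le_nhds
  · have h1 := hg'.tendsto_slope.mono_left (nhdsGT_le_nhdsNE (0 : ℝ))
    have hneg' : Tendsto (fun h : ℝ => -h) (𝓝[>] 0) (𝓝[≠] 0) := by
      refine tendsto_nhdsWithin_iff.2 ⟨hneg.mono_left nhdsWithin_le_nhds, ?_⟩
      filter_upwards [self_mem_nhdsWithin] with t ht
      have : (0 : ℝ) < t := ht
      simp [this.ne']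
    have h2 := hg'.tendsto_slope.comp hneg'
    have h3 := (h1.add h2).div_const 2
    rw [show (c + c) / 2 = c by ring] at h3
    refine h3.congr' ?_
    filter_upwards [self_mem_nhdsWithin] with t ht
    have : (0 : ℝ) < t := ht
    simp only [slope_def_field, Function.comp_def, sub_zero]
    field_simp
    ring

/-- A function whose second derivatives along the directions of each orthonormal basis exist and
add up to zero is harmonic in the weak sense. -/
theorem diffHarmonicAt_of_hasDerivAt {f : E3 → ℝ} {y : E3} (g' : E3 → ℝ → ℝ) (c : E3 → ℝ)
    (h1 : ∀ v, ‖v‖ = 1 → ∀ᶠ t : ℝ in 𝓝 0, HasDerivAt (fun t => f (y + t • v)) (g' v t) t)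
    (h2 : ∀ v, ‖v‖ = 1 → HasDerivAt (g' v) (c v) 0)
    (h3 : ∀ b : OrthonormalBasis (Fin 3) ℝ E3, ∑ i, c (b i) = 0) : DiffHarmonicAt f y := by
  intro b
  have key : Tendsto (fun h => diffLaplacian b h f y) (𝓝[>] 0) (𝓝 (∑ i, c (b i))) := by
    refine tendsto_finsetSum _ fun i _ => ?_
    have hi : ‖b i‖ = 1 := b.orthonormal.1 i
    simpa [sub_eq_add_neg] using tendsto_second_diff_quotient (h1 _ hi) (h2 _ hi)
  rwa [h3 b] at key

theorem InnerProductSpace.HarmonicAt.diffHarmonicAt {f : E3 → ℝ} {y : E3}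
    (hf : InnerProductSpace.HarmonicAt f y) : DiffHarmonicAt f y := by
  have hline : ∀ v t, HasDerivAt (fun t : ℝ => y + t • v) v t := fun v t => by
    simpa using ((hasDerivAt_id t).smul_const v).const_add y
  have hd : ∀ᶠ z in 𝓝 y, DifferentiableAt ℝ f z := by
    filter_upwards [hf.1.eventually (by simp)] with z hz
    exact hz.differentiableAt (by norm_num)
  have hd2 : DifferentiableAt ℝ (fderiv ℝ f) y :=
    (hf.1.fderiv_right (m := 1) (by norm_num)).differentiableAt (by norm_num)
  refine diffHarmonicAt_of_hasDerivAt (fun v t => fderiv ℝ f (y + t • v) v)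
    (fun v => fderiv ℝ (fderiv ℝ f) y v v) (fun v _ => ?_) (fun v _ => ?_) (fun b => ?_)
  · have : Tendsto (fun t : ℝ => y + t • v) (𝓝 0) (𝓝 y) := by
      simpa using (hline v 0).continuousAt.tendsto
    filter_upwards [this.eventually hd] with t ht
    exact ht.hasFDerivAt.comp_hasDerivAt t (hline v t)
  · have h0 : DifferentiableAt ℝ (fderiv ℝ f) (y + (0 : ℝ) • v) := by simpa using hd2
    have := h0.hasFDerivAt.comp_hasDerivAt (0 : ℝ) (hline v 0)
    simpa using this.clm_apply (hasDerivAt_const (0 : ℝ) v)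
  · have h0 := hf.2.self_of_nhds
    rw [InnerProductSpace.laplacian_eq_iteratedFDeriv_orthonormalBasis f b] at h0
    simpa [iteratedFDeriv_two_apply] using h0

/-- An isometry carries orthonormal bases to orthonormal bases; this is why `DiffHarmonicAt`
quantifies over all of them. It is needed for reflections. -/
theorem DiffHarmonicAt.comp_isometry {f : E3 → ℝ} {y c : E3} (L : E3 ≃ₗᵢ[ℝ] E3)
    (hf : DiffHarmonicAt f (L y + c)) : DiffHarmonicAt (fun y => f (L y + c)) y := by
  intro b
  refine (hf (b.map L)).congr fun h => ?_
  simp only [diffLaplacian, OrthonormalBasis.map_apply, map_add, map_sub, map_smul]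
  refine Finset.sum_congr rfl fun i _ => ?_
  rw [add_right_comm (L y) c, sub_add_eq_add_sub]

theorem OrthonormalBasis.sum_inner_mul_inner_three (b : OrthonormalBasis (Fin 3) ℝ E3) (x y : E3) :
    ∑ i, inner ℝ x (b i) * inner ℝ y (b i) = inner ℝ x y := by
  rw [← b.sum_inner_mul_inner x y]
  exact Finset.sum_congr rfl fun i _ => by rw [real_inner_comm y]

theorem diffLaplacian_norm_sq (b : OrthonormalBasis (Fin 3) ℝ E3) {h : ℝ} (hh : h ≠ 0)
    (a y : E3) : diffLaplacian b h (fun y => ‖y - a‖ ^ 2) y = 6 := by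
  have : ∀ i, (‖y + h • b i - a‖ ^ 2 + ‖y - h • b i - a‖ ^ 2 - 2 * ‖y - a‖ ^ 2) / h ^ 2 = 2 := by
    intro i
    have hi : ‖b i‖ = 1 := b.orthonormal.1 i
    have h1 : y + h • b i - a = (y - a) + h • b i := by abel
    have h2 : y - h • b i - a = (y - a) - h • b i := by abel
    rw [h1, h2, norm_add_sq_real (y - a), norm_sub_sq_real (y - a), norm_smul, hi, mul_one,
      Real.norm_eq_abs, sq_abs]
    field_simp
    ring
  simp only [diffLaplacian, this]
  norm_num

theorem diffLaplacian_inner_sq (b : OrthonormalBasis (Fin 3) ℝ E3) {h : ℝ} (hh : h ≠ 0)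
    (a y : E3) {m : E3} (hm : ‖m‖ = 1) :
    diffLaplacian b h (fun y => inner ℝ m (y - a) ^ 2) y = 2 := by
  have : ∀ i, (inner ℝ m (y + h • b i - a) ^ 2 + inner ℝ m (y - h • b i - a) ^ 2
      - 2 * inner ℝ m (y - a) ^ 2) / h ^ 2 = 2 * (inner ℝ m (b i) * inner ℝ m (b i)) := by
    intro i
    simp only [inner_sub_right, inner_add_right, inner_smul_right]
    field_simp
    ring
  simp only [diffLaplacian, this, ← Finset.mul_sum, b.sum_inner_mul_inner_three]
  rw [real_inner_self_eq_norm_sq, hm]; norm_num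

/-- The harmonic quadratic polynomial `|y - a|² - 3 t² + k t`, with `t` the height of `y` over the
plane through `a` orthogonal to `m`. -/
theorem diffHarmonicAt_barrier (a y : E3) {m : E3} (hm : ‖m‖ = 1) (k : ℝ) :
    DiffHarmonicAt (fun y => ‖y - a‖ ^ 2 - 3 * inner ℝ m (y - a) ^ 2 + k * inner ℝ m (y - a)) y := by
  intro b
  refine (tendsto_const_nhds (x := (0 : ℝ))).congr' ?_
  filter_upwards [self_mem_nhdsWithin] with h hh
  have hh' : h ≠ 0 := ne_of_gt hh
  have e1 := diffLaplacian_norm_sq b hh' a y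
  have e2 := diffLaplacian_inner_sq b hh' a y hm
  have e3 : diffLaplacian b h (fun y => inner ℝ m (y - a)) y = 0 := by
    refine Finset.sum_eq_zero fun i _ => ?_
    simp only [inner_sub_right, inner_add_right]
    ring
  rw [diffLaplacian_add, diffLaplacian_const_mul, e3]
  simp only [sub_eq_add_neg, ← neg_mul] at e1 e2 ⊢
  rw [diffLaplacian_add, diffLaplacian_const_mul, e1, e2]
  norm_num

/-! ### The maximum principle. -/

/-- The weak maximum principle. -/
theorem diffHarmonic_le_zero {U : Set E3} (hU : IsOpen U) {f : E3 → ℝ} (hc : ContinuousOn f U)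
    (hf : ∀ y ∈ U, DiffHarmonicAt f y)
    (hb : ∀ z ∈ frontier U, ∀ ε > 0, ∀ᶠ y in 𝓝[U] z, f y < ε)
    (hinf : ∀ ε > 0, ∀ᶠ y in Bornology.cobounded E3 ⊓ 𝓟 U, f y < ε) :
    ∀ y ∈ U, f y ≤ 0 := by
  intro y₀ hy₀
  by_contra! hpos
  obtain ⟨ε, hε, hε2⟩ : ∃ ε > 0, f y₀ = 2 * ε := ⟨f y₀ / 2, by linarith, by ring⟩
  set S : Set E3 := {y ∈ U | ε ≤ f y} with hS
  have hSbdd : Bornology.IsBounded S := by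
    have h := eventually_inf_principal.1 (hinf ε hε)
    rw [Bornology.isBounded_def]
    filter_upwards [h] with y hy hyS
    exact absurd (hy hyS.1) (not_lt.2 hyS.2)
  have hScl : IsClosed S := by
    refine isClosed_of_closure_subset fun z hz => ?_
    have hfr : ∃ᶠ y in 𝓝 z, y ∈ S := mem_closure_iff_frequently.1 hz
    by_cases hzU : z ∈ U
    · refine ⟨hzU, ?_⟩
      by_contra! hlt
      have := (hc.continuousAt (hU.mem_nhds hzU)).eventually (gt_mem_nhds hlt)
      obtain ⟨y, hy, hy'⟩ := (hfr.and_eventually this).exists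
      exact absurd hy' (not_lt.2 hy.2)
    · have hzf : z ∈ frontier U := by
        rw [frontier, hU.interior_eq]
        exact ⟨closure_mono (fun y hy => hy.1) hz, hzU⟩
      have := eventually_nhdsWithin_iff.1 (hb z hzf ε hε)
      obtain ⟨y, hy, hy'⟩ := (hfr.and_eventually this).exists
      exact absurd (hy' hy.1) (not_lt.2 hy.2)
  have hScomp : IsCompact S := Metric.isCompact_of_isClosed_isBounded hScl hSbdd
  obtain ⟨R, hR, hSR⟩ : ∃ R > 0, S ⊆ Metric.ball y₀ R := by
    obtain ⟨R, hR⟩ := hSbdd.subset_ball y₀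
    exact ⟨max R 1, by positivity, hR.trans (Metric.ball_subset_ball (le_max_left _ _))⟩
  -- Chosen so that the strictly subharmonic perturbation `δ |y - y₀|²` is at most `ε` on the ball.
  -- Outside `S` the perturbed function is then below `2 ε`, its value at `y₀`, and the maximum over
  -- `S` is a local maximum. There the discrete Laplacian is nonpositive, whereas its limit is `6
  -- δ`.
  set δ : ℝ := ε / R ^ 2 with hδ
  have hδ0 : 0 < δ := by positivity
  have hy₀S : y₀ ∈ S := ⟨hy₀, by linarith⟩
  obtain ⟨y₁, hy₁, hmax⟩ := hScomp.exists_isMaxOn ⟨y₀, hy₀S⟩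
    (f := fun y => f y + δ * ‖y - y₀‖ ^ 2)
    ((hc.mono fun y hy => hy.1).add (by fun_prop))
  have h1 : 2 * ε ≤ f y₁ + δ * ‖y₁ - y₀‖ ^ 2 := by
    have : f y₀ + δ * ‖y₀ - y₀‖ ^ 2 ≤ _ := hmax hy₀S
    simpa [hε2] using this
  have hloc : ∀ᶠ y in 𝓝 y₁, f y + δ * ‖y - y₀‖ ^ 2 ≤ f y₁ + δ * ‖y₁ - y₀‖ ^ 2 := by
    filter_upwards [hU.mem_nhds hy₁.1, Metric.isOpen_ball.mem_nhds (hSR hy₁)] with y hyU hyR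
    by_cases hyS : y ∈ S
    · exact hmax hyS
    · have h2 : f y < ε := by
        by_contra! h; exact hyS ⟨hyU, h⟩
      have h3 : δ * ‖y - y₀‖ ^ 2 ≤ ε := by
        rw [mem_ball_iff_norm] at hyR
        calc δ * ‖y - y₀‖ ^ 2 ≤ δ * R ^ 2 := by gcongr
          _ = ε := by rw [hδ]; field_simp
      linarith
  let b := EuclideanSpace.basisFun (Fin 3) ℝ
  have hlim : Tendsto (fun h => diffLaplacian b h f y₁ + δ * 6) (𝓝[>] 0) (𝓝 (0 + δ * 6)) :=
    (hf y₁ hy₁.1 b).add_const _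
  have hle : ∀ᶠ h : ℝ in 𝓝[>] 0, diffLaplacian b h f y₁ + δ * 6 ≤ 0 := by
    have key : ∀ i : Fin 3, ∀ s : ℝ, ∀ᶠ h : ℝ in 𝓝[>] 0,
        f (y₁ + h • (s • b i)) + δ * ‖y₁ + h • (s • b i) - y₀‖ ^ 2
          ≤ f y₁ + δ * ‖y₁ - y₀‖ ^ 2 := by
      intro i s
      have : Tendsto (fun h : ℝ => y₁ + h • (s • b i)) (𝓝[>] 0) (𝓝 y₁) := by
        have : ContinuousAt (fun h : ℝ => y₁ + h • (s • b i)) 0 := by fun_prop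
        simpa using this.tendsto.mono_left nhdsWithin_le_nhds
      exact this.eventually hloc
    filter_upwards [eventually_all.2 fun i => key i 1, eventually_all.2 fun i => key i (-1),
      self_mem_nhdsWithin] with h hp hm hh
    have hh' : h ≠ 0 := ne_of_gt hh
    rw [← diffLaplacian_norm_sq b hh' y₀ y₁, ← diffLaplacian_const_mul, ← diffLaplacian_add]
    refine Finset.sum_nonpos fun i _ => div_nonpos_of_nonpos_of_nonneg ?_ (sq_nonneg h)
    have a1 := hp i
    have a2 := hm i
    simp only [one_smul, neg_smul, smul_neg, ← sub_eq_add_neg] at a1 a2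
    linarith
  have := le_of_tendsto hlim hle
  linarith

/-! ### The fundamental solution and the dipole. -/

theorem hasDerivAt_norm_line {u v : E3} (hv : ‖v‖ = 1) {t : ℝ} (h : u + t • v ≠ 0) :
    HasDerivAt (fun t : ℝ => ‖u + t • v‖) ((inner ℝ u v + t) / ‖u + t • v‖) t := by
  have hl : HasDerivAt (fun t : ℝ => u + t • v) v t := by
    simpa using ((hasDerivAt_id t).smul_const v).const_add u
  have h1 := (hl.norm_sq).sqrt (by positivity)
  simp only [Real.sqrt_sq (norm_nonneg _)] at h1
  refine (h1).congr_deriv ?_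
  rw [inner_add_left, inner_smul_left, real_inner_self_eq_norm_sq, hv]
  simp
  field_simp

theorem abs_inner_add_le {u v : E3} (hv : ‖v‖ = 1) (t : ℝ) :
    |inner ℝ u v + t| ≤ ‖u + t • v‖ := by
  have : inner ℝ u v + t = inner ℝ (u + t • v) v := by
    rw [inner_add_left, inner_smul_left, real_inner_self_eq_norm_sq, hv]; simp
  rw [this]
  simpa [hv] using abs_real_inner_le_norm (u + t • v) v

theorem hasDerivAt_inner_add (u v : E3) (t : ℝ) :
    HasDerivAt (fun t : ℝ => inner ℝ u v + t) 1 t := (hasDerivAt_id t).const_add _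

theorem hasDerivAt_inv_norm_line {u v : E3} (hv : ‖v‖ = 1) {t : ℝ} (h : u + t • v ≠ 0) :
    HasDerivAt (fun t : ℝ => ‖u + t • v‖⁻¹) (-(inner ℝ u v + t) / ‖u + t • v‖ ^ 3) t := by
  have h0 : ‖u + t • v‖ ≠ 0 := norm_ne_zero_iff.2 h
  refine ((hasDerivAt_norm_line hv h).inv h0).congr_deriv ?_
  field_simp

theorem hasDerivAt_inv_norm_line_two {u v : E3} (hv : ‖v‖ = 1) {t : ℝ} (h : u + t • v ≠ 0) :
    HasDerivAt (fun t : ℝ => -(inner ℝ u v + t) / ‖u + t • v‖ ^ 3)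
      (-1 / ‖u + t • v‖ ^ 3 + 3 * (inner ℝ u v + t) ^ 2 / ‖u + t • v‖ ^ 5) t := by
  have h0 : ‖u + t • v‖ ≠ 0 := norm_ne_zero_iff.2 h
  refine ((hasDerivAt_inner_add u v t).fun_neg.fun_div ((hasDerivAt_norm_line hv h).fun_pow 3)
    (by positivity)).congr_deriv ?_
  field_simp
  push_cast
  ring

theorem hasDerivAt_inv_norm_line_three {u v : E3} (hv : ‖v‖ = 1) {t : ℝ} (h : u + t • v ≠ 0) :
    HasDerivAt
      (fun t : ℝ => -1 / ‖u + t • v‖ ^ 3 + 3 * (inner ℝ u v + t) ^ 2 / ‖u + t • v‖ ^ 5)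
      (9 * (inner ℝ u v + t) / ‖u + t • v‖ ^ 5
        - 15 * (inner ℝ u v + t) ^ 3 / ‖u + t • v‖ ^ 7) t := by
  have h0 : ‖u + t • v‖ ≠ 0 := norm_ne_zero_iff.2 h
  have hn := hasDerivAt_norm_line hv h
  have h1 := (hasDerivAt_const t (-1 : ℝ)).fun_div (hn.fun_pow 3) (by positivity)
  have h2 := (((hasDerivAt_inner_add u v t).fun_pow 2).const_mul 3).fun_div (hn.fun_pow 5) (by positivity)
  refine (h1.fun_add h2).congr_deriv ?_
  field_simp
  push_cast
  ring

/-- Quantitative convergence of the second centred difference quotient. -/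
theorem abs_second_diff_quotient_sub_le {g g₁ g₂ g₃ : ℝ → ℝ} {h M : ℝ} (hh : 0 < h)
    (h1 : ∀ t ∈ Set.Icc (-h) h, HasDerivAt g (g₁ t) t)
    (h2 : ∀ t ∈ Set.Icc (-h) h, HasDerivAt g₁ (g₂ t) t)
    (h3 : ∀ t ∈ Set.Icc (-h) h, HasDerivAt g₂ (g₃ t) t)
    (hM : ∀ t ∈ Set.Icc (-h) h, |g₃ t| ≤ M) :
    |(g h + g (-h) - 2 * g 0) / h ^ 2 - g₂ 0| ≤ 2 * M * h := by
  have hM0 : 0 ≤ M := (abs_nonneg _).trans (hM 0 ⟨by linarith, by linarith⟩)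
  have m0 : (0 : ℝ) ∈ Set.Icc (-h) h := ⟨by linarith, by linarith⟩
  have neg_mem : ∀ {t}, t ∈ Set.Icc (-h) h → -t ∈ Set.Icc (-h) h := fun ht =>
    ⟨by linarith [ht.2], by linarith [ht.1]⟩
  have s1 : ∀ t ∈ Set.Icc (-h) h, |g₂ t - g₂ 0| ≤ M * h := fun t ht => by
    have := (convex_Icc (-h) h).norm_image_sub_le_of_norm_hasDerivWithin_le
      (fun x hx => (h3 x hx).hasDerivWithinAt) hM m0 ht
    simp only [Real.norm_eq_abs, sub_zero] at this
    exact this.trans (by gcongr; exact abs_le.2 ht)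
  have s2 : ∀ t ∈ Set.Icc (-h) h, |g₁ t - g₁ (-t) - 2 * t * g₂ 0| ≤ 2 * M * h * h :=
    fun t ht => by
    have hd : ∀ x ∈ Set.Icc (-h) h, HasDerivWithinAt (fun t => g₁ t - g₁ (-t) - 2 * t * g₂ 0)
        (g₂ x + g₂ (-x) - 2 * g₂ 0) (Set.Icc (-h) h) x := fun x hx => by
      have a1 := (h2 (-x) (neg_mem hx)).scomp x (hasDerivAt_neg x)
      have a2 := (((hasDerivAt_id x).const_mul 2).mul_const (g₂ 0))
      have := ((h2 x hx).sub a1).sub a2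
      simpa [Function.comp_def, Pi.sub_def] using this.hasDerivWithinAt
    have := (convex_Icc (-h) h).norm_image_sub_le_of_norm_hasDerivWithin_le hd
      (C := 2 * M * h) (fun x hx => by
        have a1 := abs_le.1 (s1 x hx)
        have a2 := abs_le.1 (s1 (-x) (neg_mem hx))
        rw [Real.norm_eq_abs, abs_le]
        constructor <;> linarith) m0 ht
    simp only [Real.norm_eq_abs, sub_zero, neg_zero, sub_self, mul_zero, zero_mul] at this
    exact this.trans (by gcongr; exact abs_le.2 ht)
  have s3 : |g h + g (-h) - 2 * g 0 - h ^ 2 * g₂ 0| ≤ 2 * M * h * h * h := by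
    have hd : ∀ x ∈ Set.Icc (-h) h, HasDerivWithinAt
        (fun t => g t + g (-t) - 2 * g 0 - t ^ 2 * g₂ 0)
        (g₁ x - g₁ (-x) - 2 * x * g₂ 0) (Set.Icc (-h) h) x := fun x hx => by
      have a1 := (h1 (-x) (neg_mem hx)).scomp x (hasDerivAt_neg x)
      have a2 := ((hasDerivAt_pow 2 x).mul_const (g₂ 0))
      have := (((h1 x hx).add a1).sub_const (2 * g 0)).sub a2
      simpa [Function.comp_def, Pi.sub_def, Pi.add_def, sub_eq_add_neg] using
        this.hasDerivWithinAt
    have := (convex_Icc (-h) h).norm_image_sub_le_of_norm_hasDerivWithin_le hd s2 m0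
      (⟨by linarith, le_refl h⟩ : h ∈ Set.Icc (-h) h)
    simp only [Real.norm_eq_abs, sub_zero, neg_zero, abs_of_pos hh] at this
    have e : g 0 + g 0 - 2 * g 0 - 0 ^ 2 * g₂ 0 = 0 := by ring
    rwa [e, sub_zero] at this
  have e : (g h + g (-h) - 2 * g 0) / h ^ 2 - g₂ 0
      = (g h + g (-h) - 2 * g 0 - h ^ 2 * g₂ 0) / h ^ 2 := by field_simp
  rw [e, abs_div, abs_of_pos (by positivity : 0 < h ^ 2), div_le_iff₀ (by positivity)]
  calc _ ≤ _ := s3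
    _ = _ := by ring

/-- The second derivatives along an orthonormal basis add up to zero, so only the third-order error
remains. The bound depends on `a` only through `‖y - a‖`, hence is uniform over boundary points `a`
when `y` is an interior pole. -/
theorem abs_diffLaplacian_inv_norm_le (b : OrthonormalBasis (Fin 3) ℝ E3) {y a : E3} {h : ℝ}
    (hh : 0 < h) (hya : 2 * h ≤ ‖y - a‖) :
    |diffLaplacian b h (fun y => ‖y - a‖⁻¹) y| ≤ 2304 * h / ‖y - a‖ ^ 4 := by
  set u := y - a with hu
  have hu0 : 0 < ‖u‖ := by linarith
  have hlow : ∀ v : E3, ‖v‖ = 1 → ∀ t ∈ Set.Icc (-h) h, ‖u‖ / 2 ≤ ‖u + t • v‖ := by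
    intro v hv t ht
    have h1 : ‖u‖ ≤ ‖u + t • v‖ + ‖t • v‖ := by simpa using norm_sub_le (u + t • v) (t • v)
    rw [norm_smul, hv, Real.norm_eq_abs, mul_one] at h1
    have := abs_le.2 ht
    linarith
  have hne : ∀ v : E3, ‖v‖ = 1 → ∀ t ∈ Set.Icc (-h) h, u + t • v ≠ 0 := fun v hv t ht => by
    have := hlow v hv t ht
    rw [← norm_pos_iff]; linarith
  have key : ∀ i, |(‖y + h • b i - a‖⁻¹ + ‖y - h • b i - a‖⁻¹ - 2 * ‖y - a‖⁻¹) / h ^ 2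
      - (-1 / ‖u‖ ^ 3 + 3 * inner ℝ u (b i) ^ 2 / ‖u‖ ^ 5)| ≤ 2 * (384 / ‖u‖ ^ 4) * h := by
    intro i
    have hi : ‖b i‖ = 1 := b.orthonormal.1 i
    -- The third derivative is at most `(9 + 15) / N⁴` with `N ≥ ‖u‖ / 2`, and `24 * 2⁴ = 384`.
    -- Three directions, each with error `2 M h`, give `2304`.
    have := abs_second_diff_quotient_sub_le (g := fun t => ‖u + t • b i‖⁻¹) (M := 384 / ‖u‖ ^ 4) hh
      (fun t ht => hasDerivAt_inv_norm_line hi (hne _ hi t ht))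
      (fun t ht => hasDerivAt_inv_norm_line_two hi (hne _ hi t ht))
      (fun t ht => hasDerivAt_inv_norm_line_three hi (hne _ hi t ht))
      (fun t ht => by
        have l1 := hlow _ hi t ht
        have l2 := abs_inner_add_le hi (u := u) t
        set N := ‖u + t • b i‖
        set α := inner ℝ u (b i) + t
        have hN : 0 < N := by linarith
        have e1 : |9 * α / N ^ 5| ≤ 9 / N ^ 4 := by
          rw [abs_div, abs_of_pos (by positivity : 0 < N ^ 5), abs_mul, div_le_div_iff₀ (by positivity) (by positivity)]
          simp only [Nat.abs_ofNat]
          nlinarith [pow_pos hN 4]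
        have e2 : |15 * α ^ 3 / N ^ 7| ≤ 15 / N ^ 4 := by
          have : |α| ^ 3 ≤ N ^ 3 := by gcongr
          rw [abs_div, abs_of_pos (by positivity : 0 < N ^ 7), abs_mul, abs_pow, div_le_div_iff₀ (by positivity) (by positivity)]
          simp only [Nat.abs_ofNat]
          nlinarith [pow_pos hN 4]
        calc _ ≤ |9 * α / N ^ 5| + |15 * α ^ 3 / N ^ 7| := abs_sub _ _
          _ ≤ 9 / N ^ 4 + 15 / N ^ 4 := add_le_add e1 e2
          _ = 24 / N ^ 4 := by ring
          _ ≤ 24 / (‖u‖ / 2) ^ 4 := by gcongr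
          _ = _ := by field_simp; norm_num)
    simp only [zero_smul, add_zero, neg_smul] at this
    rw [hu] at this ⊢
    rw [show y + h • b i - a = y - a + h • b i by abel,
      show y - h • b i - a = y - a + -(h • b i) by abel]
    exact this
  have hsum : ∑ i, (-1 / ‖u‖ ^ 3 + 3 * inner ℝ u (b i) ^ 2 / ‖u‖ ^ 5) = 0 := by
    have := b.sum_inner_mul_inner_three u u
    rw [real_inner_self_eq_norm_sq] at this
    simp only [← pow_two] at this
    calc _ = ∑ i : Fin 3, -1 / ‖u‖ ^ 3 + 3 / ‖u‖ ^ 5 * ∑ i, inner ℝ u (b i) ^ 2 := by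
          rw [Finset.mul_sum, ← Finset.sum_add_distrib]
          exact Finset.sum_congr rfl fun i _ => by ring
      _ = 0 := by
          rw [this]
          simp
          field_simp
          norm_num
  rw [← sub_zero (diffLaplacian _ _ _ _), ← hsum, diffLaplacian, ← Finset.sum_sub_distrib]
  calc _ ≤ ∑ i : Fin 3, _ := Finset.abs_sum_le_sum_abs _ _
    _ ≤ ∑ i : Fin 3, 2 * (384 / ‖u‖ ^ 4) * h := Finset.sum_le_sum fun i _ => key i
    _ = _ := by simp; ring

theorem diffHarmonicAt_inv_norm {y a : E3} (hya : y ≠ a) :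
    DiffHarmonicAt (fun y => ‖y - a‖⁻¹) y := by
  intro b
  have h0 : 0 < ‖y - a‖ := norm_pos_iff.2 (sub_ne_zero.2 hya)
  have hlim : Tendsto (fun h : ℝ => 2304 * h / ‖y - a‖ ^ 4) (𝓝[>] 0) (𝓝 0) := by
    have : ContinuousAt (fun h : ℝ => 2304 * h / ‖y - a‖ ^ 4) 0 := by fun_prop
    simpa using this.tendsto.mono_left nhdsWithin_le_nhds
  refine squeeze_zero_norm' ?_ hlim
  filter_upwards [self_mem_nhdsWithin,
    nhdsWithin_le_nhds (gt_mem_nhds (half_pos h0))] with h hh hh2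
  exact abs_diffLaplacian_inv_norm_le b hh (by linarith)

theorem diffHarmonicAt_dipole (n : E3) {y a : E3} (hya : y ≠ a) :
    DiffHarmonicAt (fun y => inner ℝ n (y - a) / ‖y - a‖ ^ 3) y := by
  set u := y - a with hu
  have hu0 : u ≠ 0 := sub_ne_zero.2 hya
  have hN : 0 < ‖u‖ := norm_pos_iff.2 hu0
  have hsub : ∀ (v : E3) (t : ℝ), y + t • v - a = u + t • v := fun v t => by rw [hu]; abel
  have hin : ∀ (v : E3) (t : ℝ),
      HasDerivAt (fun t : ℝ => inner ℝ n (u + t • v)) (inner ℝ n v) t := fun v t => by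
    simp only [inner_add_right, inner_smul_right]
    simpa using ((hasDerivAt_id t).mul_const (inner ℝ n v)).const_add (inner ℝ n u)
  refine diffHarmonicAt_of_hasDerivAt
    (fun v t => inner ℝ n v / ‖u + t • v‖ ^ 3
      - 3 * inner ℝ n (u + t • v) * (inner ℝ u v + t) / ‖u + t • v‖ ^ 5)
    (fun v => -6 * (inner ℝ n v * inner ℝ u v) / ‖u‖ ^ 5 - 3 * inner ℝ n u / ‖u‖ ^ 5
      + 15 * inner ℝ n u * inner ℝ u v ^ 2 / ‖u‖ ^ 7) (fun v hv => ?_) (fun v hv => ?_)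
    (fun b => ?_)
  · have : ContinuousAt (fun t : ℝ => u + t • v) 0 := by fun_prop
    have hev := this.eventually_ne (y := (0 : E3)) (by simpa using hu0)
    filter_upwards [hev] with t ht
    have h0 : ‖u + t • v‖ ≠ 0 := norm_ne_zero_iff.2 ht
    simp only [hsub]
    refine ((hin v t).fun_div ((hasDerivAt_norm_line hv ht).fun_pow 3)
      (by positivity)).congr_deriv ?_
    field_simp
    push_cast
    ring
  · have ht : u + (0 : ℝ) • v ≠ 0 := by simpa using hu0
    have h0 : ‖u + (0 : ℝ) • v‖ ≠ 0 := norm_ne_zero_iff.2 ht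
    have hn := hasDerivAt_norm_line hv ht
    have h1 := (hasDerivAt_const (0 : ℝ) (inner ℝ n v : ℝ)).fun_div (hn.fun_pow 3) (by positivity)
    have h2 := (((hin v 0).const_mul 3).fun_mul (hasDerivAt_inner_add u v 0)).fun_div (hn.fun_pow 5)
      (by positivity)
    refine (h1.fun_sub h2).congr_deriv ?_
    simp only [zero_smul, add_zero] at h0 ⊢
    field_simp
    push_cast
    ring
  · have e1 := b.sum_inner_mul_inner_three n u
    have e2 := b.sum_inner_mul_inner_three u u
    rw [real_inner_self_eq_norm_sq] at e2
    simp only [← pow_two] at e2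
    calc _ = -6 / ‖u‖ ^ 5 * ∑ i, inner ℝ n (b i) * inner ℝ u (b i)
          - ∑ i : Fin 3, 3 * inner ℝ n u / ‖u‖ ^ 5
          + 15 * inner ℝ n u / ‖u‖ ^ 7 * ∑ i, inner ℝ u (b i) ^ 2 := by
          rw [Finset.mul_sum, Finset.mul_sum, ← Finset.sum_sub_distrib, ← Finset.sum_add_distrib]
          exact Finset.sum_congr rfl fun i _ => by ring
      _ = 0 := by
          rw [e1, e2]
          simp
          field_simp
          ring

/-! ### Reflections and the interior gradient estimate. -/

/-- Reflection across the plane through `a` orthogonal to `e`. -/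
noncomputable def planeReflection (a e y : E3) : E3 := y - (2 * inner ℝ e (y - a)) • e

theorem planeReflection_sub_self_sq (a y z : E3) {e : E3} (he : ‖e‖ = 1) :
    ‖planeReflection a e y - z‖ ^ 2 = ‖y - z‖ ^ 2 + 4 * inner ℝ e (y - a) * inner ℝ e (z - a) := by
  have : planeReflection a e y - z = (y - z) - (2 * inner ℝ e (y - a)) • e := by
    rw [planeReflection]; abel
  have h2 : inner ℝ e (y - z) = inner ℝ e (y - a) - inner ℝ e (z - a) := by
    rw [← inner_sub_right, sub_sub_sub_cancel_right]
  rw [this, norm_sub_sq_real, inner_smul_right, norm_smul, he, Real.norm_eq_abs, mul_one, sq_abs,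
    real_inner_comm e (y - z), h2]
  ring

theorem planeReflection_eq (a y : E3) {e : E3} (he : ‖e‖ = 1) :
    planeReflection a e y = (ℝ ∙ e)ᗮ.reflection y + (2 * inner ℝ e a) • e := by
  rw [planeReflection, Submodule.reflection_orthogonal_apply,
    Submodule.reflection_singleton_apply, he, inner_sub_right]
  simp only [RCLike.ofReal_real_eq_id, id, one_pow, div_one, two_smul, mul_sub, sub_smul, two_mul,
    add_smul]
  abel

theorem continuous_planeReflection (a e : E3) : Continuous (planeReflection a e) := by
  unfold planeReflection
  fun_prop

theorem DiffHarmonicAt.comp_planeReflection {f : E3 → ℝ} {a e y : E3} (he : ‖e‖ = 1)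
    (hf : DiffHarmonicAt f (planeReflection a e y)) :
    DiffHarmonicAt (fun y => f (planeReflection a e y)) y := by
  simp only [planeReflection_eq a _ he] at hf ⊢
  exact hf.comp_isometry _

/-- Interior gradient estimate, along a direction: a harmonic function on a ball of radius `R`
bounded by `M` changes at a rate at most `3 M / R` at the centre. -/
theorem abs_sub_le_of_diffHarmonic {f : E3 → ℝ} {x e : E3} {R M : ℝ} (hR : 0 < R)
    (he : ‖e‖ = 1) (hc : ContinuousOn f (Metric.ball x R))
    (hf : ∀ y ∈ Metric.ball x R, DiffHarmonicAt f y) (hM : ∀ y ∈ Metric.ball x R, |f y| ≤ M)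
    {t : ℝ} (ht : 0 < t) (htR : t < R) : f (x + t • e) - f (x - t • e) ≤ 6 * M * t / R := by
  have hM0 : 0 ≤ M := (abs_nonneg _).trans (hM x (Metric.mem_ball_self hR))
  -- The odd part of `f` across the plane vanishes on that plane and is at most `2 M`. On the
  -- half-ball `q` is nonnegative on the flat face, and at least `R²` on the cap because the height
  -- there lies between `0` and `R`. So `(2 M / R²) q` dominates the odd part, and it is linear in
  -- the height to leading order.
  set q : E3 → ℝ := fun y =>
    ‖y - x‖ ^ 2 - 3 * inner ℝ e (y - x) ^ 2 + (3 * R) * inner ℝ e (y - x) with hq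
  set A : E3 → E3 := planeReflection x e with hA
  have hAball : ∀ y, y ∈ Metric.ball x R → A y ∈ Metric.ball x R := fun y hy => by
    rw [mem_ball_iff_norm] at hy ⊢
    have := planeReflection_sub_self_sq x y x he
    rw [sub_self, inner_zero_right, mul_zero, add_zero] at this
    rwa [hA, (pow_left_inj₀ (norm_nonneg _) (norm_nonneg _) two_ne_zero).1 this]
  set U : Set E3 := Metric.ball x R ∩ {y | 0 < inner ℝ e (y - x)} with hU
  have hlin : Continuous fun y : E3 => inner ℝ e (y - x) := by fun_prop
  have hUo : IsOpen U := Metric.isOpen_ball.inter (isOpen_lt continuous_const hlin)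
  have hqc : Continuous q := by fun_prop
  have hfr : ∀ z ∈ frontier U, ‖z - x‖ ≤ R ∧ 0 ≤ inner ℝ e (z - x) ∧
      (‖z - x‖ < R → inner ℝ e (z - x) = 0) := by
    intro z hz
    rw [frontier, hUo.interior_eq] at hz
    have h1 : z ∈ closure U := hz.1
    have h2 : ‖z - x‖ ≤ R := by
      have : closure U ⊆ {z | ‖z - x‖ ≤ R} :=
        closure_minimal (fun y hy => (mem_ball_iff_norm.1 hy.1).le)
          (isClosed_le (by fun_prop) continuous_const)
      exact this h1
    have h3 : 0 ≤ inner ℝ e (z - x) := by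
      have : closure U ⊆ {z | 0 ≤ inner ℝ e (z - x)} :=
        closure_minimal (fun y hy => (show 0 < inner ℝ e (y - x) from hy.2).le)
          (isClosed_le continuous_const hlin)
      exact this h1
    refine ⟨h2, h3, fun h => le_antisymm ?_ h3⟩
    by_contra! h4
    exact hz.2 ⟨mem_ball_iff_norm.2 h, h4⟩
  have hcA : ContinuousOn (fun y => f (A y)) (Metric.ball x R) :=
    hc.comp (continuous_planeReflection x e).continuousOn hAball
  have key := diffHarmonic_le_zero hUo (f := fun y => (f y - f (A y)) - (2 * M / R ^ 2) * q y)
    (((hc.sub hcA).mono Set.inter_subset_left).sub (by fun_prop))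
    (fun y hy => ((hf y hy.1).sub ((hf _ (hAball y hy.1)).comp_planeReflection he)).sub
      ((diffHarmonicAt_barrier x y he (3 * R)).const_mul _))
    (fun z hz ε hε => by
      obtain ⟨h1, h2, h3⟩ := hfr z hz
      rcases h1.lt_or_eq with h1 | h1
      · have hzb : z ∈ Metric.ball x R := mem_ball_iff_norm.2 h1
        have hAz : A z = z := by simp [hA, planeReflection, h3 h1]
        have hcont : ContinuousAt (fun y => (f y - f (A y)) - (2 * M / R ^ 2) * q y) z :=
          ((hc.sub hcA).continuousAt (Metric.isOpen_ball.mem_nhds hzb)).sub (by fun_prop)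
        refine (hcont.eventually (gt_mem_nhds ?_)).filter_mono nhdsWithin_le_nhds
        simp only [hAz, sub_self, hq, h3 h1]
        have : 0 ≤ 2 * M / R ^ 2 * ‖z - x‖ ^ 2 := by positivity
        nlinarith
      · have h4 : R ^ 2 ≤ q z := by
          have h5 : inner ℝ e (z - x) ≤ R := by
            have := real_inner_le_norm e (z - x)
            rwa [he, one_mul, h1] at this
          simp only [hq, h1]
          nlinarith
        have h5 : 2 * M - ε < 2 * M / R ^ 2 * q z := by
          have : 2 * M ≤ 2 * M / R ^ 2 * q z := by
            rw [div_mul_eq_mul_div, le_div_iff₀ (by positivity)]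
            gcongr
          linarith
        have hcont : ContinuousAt (fun y => 2 * M / R ^ 2 * q y) z := by fun_prop
        filter_upwards [(hcont.eventually (lt_mem_nhds h5)).filter_mono nhdsWithin_le_nhds,
          self_mem_nhdsWithin] with y hy hyU
        have a1 := abs_le.1 (hM y hyU.1)
        have a2 := abs_le.1 (hM _ (hAball y hyU.1))
        linarith)
    (fun ε hε => by
      have hb : Bornology.IsBounded U := Metric.isBounded_ball.subset Set.inter_subset_left
      have : Uᶜ ∈ Bornology.cobounded E3 := Bornology.isBounded_def.1 hb
      rw [eventually_inf_principal]
      filter_upwards [this] with y hy hy'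
      exact absurd hy' hy)
  have hte : inner ℝ e (x + t • e - x) = t := by
    simp [inner_smul_right, he]
  have hxt : x + t • e ∈ U := by
    refine ⟨?_, ?_⟩
    · rw [mem_ball_iff_norm, add_sub_cancel_left, norm_smul, he, Real.norm_eq_abs, abs_of_pos ht]
      linarith
    · change 0 < inner ℝ e (x + t • e - x)
      rwa [hte]
  have hAt : A (x + t • e) = x - t • e := by
    rw [hA, planeReflection, hte, two_mul, add_smul]; abel
  have hk := key _ hxt
  have hnt : ‖x + t • e - x‖ = t := by
    rw [add_sub_cancel_left, norm_smul, he, Real.norm_eq_abs, abs_of_pos ht, mul_one]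
  simp only [hAt, hq, hte, hnt] at hk
  have h2 : 2 * M / R ^ 2 * (t ^ 2 - 3 * t ^ 2 + 3 * R * t) ≤ 6 * M * t / R := by
    have : 6 * M * t / R - 2 * M / R ^ 2 * (t ^ 2 - 3 * t ^ 2 + 3 * R * t)
        = 4 * M * t ^ 2 / R ^ 2 := by field_simp; ring
    have : 0 ≤ 4 * M * t ^ 2 / R ^ 2 := by positivity
    linarith
  linarith

/-- Interior gradient estimate. -/
theorem norm_gradient_le_of_diffHarmonic {f : E3 → ℝ} {x : E3} {R M : ℝ} (hR : 0 < R)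
    (hc : ContinuousOn f (Metric.ball x R))
    (hf : ∀ y ∈ Metric.ball x R, DiffHarmonicAt f y) (hM : ∀ y ∈ Metric.ball x R, |f y| ≤ M)
    (hd : DifferentiableAt ℝ f x) : ‖gradient f x‖ ≤ 3 * M / R := by
  have hM0 : 0 ≤ M := (abs_nonneg _).trans (hM x (Metric.mem_ball_self hR))
  rcases eq_or_ne (gradient f x) 0 with h0 | h0
  · rw [h0, norm_zero]; positivity
  set e : E3 := ‖gradient f x‖⁻¹ • gradient f x with he_def
  have hg0 : ‖gradient f x‖ ≠ 0 := norm_ne_zero_iff.2 h0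
  have he : ‖e‖ = 1 := by rw [he_def, norm_smul, norm_inv, norm_norm, inv_mul_cancel₀ hg0]
  have hfe : fderiv ℝ f x e = ‖gradient f x‖ := by
    have : fderiv ℝ f x e = inner ℝ (gradient f x) e := by
      rw [gradient, InnerProductSpace.toDual_symm_apply]
    rw [this, he_def, inner_smul_right, real_inner_self_eq_norm_sq]
    field_simp
  have hline : ∀ s : ℝ, HasDerivAt (fun t : ℝ => f (x + t • (s • e))) (s * fderiv ℝ f x e) 0 := by
    intro s
    have hl : HasDerivAt (fun t : ℝ => x + t • (s • e)) (s • e) 0 := by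
      simpa using ((hasDerivAt_id (0 : ℝ)).smul_const (s • e)).const_add x
    have h0 : DifferentiableAt ℝ f (x + (0 : ℝ) • (s • e)) := by simpa using hd
    refine (h0.hasFDerivAt.comp_hasDerivAt (0 : ℝ) hl).congr_deriv ?_
    rw [zero_smul, add_zero, ContinuousLinearMap.map_smul _ s e, smul_eq_mul]
  have hdiff : HasDerivAt (fun t : ℝ => f (x + t • e) - f (x - t • e)) (2 * ‖gradient f x‖) 0 := by
    have := ((hline 1).fun_sub (hline (-1))).congr_deriv
      (show _ = 2 * ‖gradient f x‖ by rw [hfe]; ring)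
    simpa only [one_smul, neg_smul, smul_neg, ← sub_eq_add_neg] using this
  have hlim := hdiff.tendsto_slope.mono_left (nhdsGT_le_nhdsNE (0 : ℝ))
  have hle : ∀ᶠ t : ℝ in 𝓝[>] 0,
      slope (fun t : ℝ => f (x + t • e) - f (x - t • e)) 0 t ≤ 6 * M / R := by
    filter_upwards [self_mem_nhdsWithin, nhdsWithin_le_nhds (gt_mem_nhds hR)] with t ht htR
    have ht' : 0 < t := ht
    have := abs_sub_le_of_diffHarmonic hR he hc hf hM ht' htR
    rw [slope_def_field]
    simp only [zero_smul, add_zero, sub_zero, sub_self]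
    rw [div_le_iff₀ ht']
    calc _ ≤ _ := this
      _ = _ := by ring
  have := le_of_tendsto hlim hle
  have e1 : 6 * M / R = 2 * (3 * M / R) := by ring
  linarith

/-! ### Geometry of the domain: interior balls, normals, nearest points. -/

theorem norm_fderiv_fderiv {E : Type*} [NormedAddCommGroup E] [NormedSpace ℝ E] (f : E → ℝ)
    (x : E) : ‖fderiv ℝ (fderiv ℝ f) x‖ = ‖iteratedFDeriv ℝ 2 f x‖ := by
  rw [← norm_iteratedFDeriv_one, norm_iteratedFDeriv_fderiv]

/-- A convex open set containing a ball whose boundary passes through a point `q` outside of the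
set lies on one side of the tangent plane of the ball at `q`. -/
theorem inner_pos_of_ball_subset {D : Set E3} (hDo : IsOpen D) (hDc : Convex ℝ D) {c q : E3}
    (hq : q ∉ D) (hcq : c ≠ q) (hball : Metric.ball c ‖c - q‖ ⊆ D) {y : E3} (hy : y ∈ D) :
    0 < inner ℝ (c - q) (y - q) := by
  obtain ⟨f, hf⟩ := geometric_hahn_banach_open_point hDc hDo hq
  set v : E3 := -(InnerProductSpace.toDual ℝ E3).symm f with hv
  have hfv : ∀ z ∈ D, 0 < inner ℝ v (z - q) := fun z hz => by
    rw [hv, inner_neg_left, InnerProductSpace.toDual_symm_apply, map_sub]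
    linarith [hf z hz]
  set ρ := ‖c - q‖ with hρ
  have hρ0 : 0 < ρ := norm_pos_iff.2 (sub_ne_zero.2 hcq)
  have hv0 : v ≠ 0 := fun h => by simpa [h] using hfv y hy
  have hvn : 0 < ‖v‖ := norm_pos_iff.2 hv0
  -- The supporting functional is positive on the whole ball, in particular at points just short of
  -- its lowest point in the direction `v`. This is the equality case of Cauchy–Schwarz, so `v` is
  -- parallel to `c - q`.
  have hge : ρ * ‖v‖ ≤ inner ℝ v (c - q) := by
    by_contra! hlt
    have h1 : ∀ θ : ℝ, 0 ≤ θ → θ < 1 → θ * (ρ * ‖v‖) < inner ℝ v (c - q) := fun θ h0 h1 => by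
      have hmem : c - (θ * ρ / ‖v‖) • v ∈ D := hball (by
        rw [mem_ball_iff_norm, sub_sub_cancel_left, norm_neg, norm_smul, Real.norm_eq_abs,
          abs_of_nonneg (by positivity), div_mul_cancel₀ _ hvn.ne']
        nlinarith)
      have := hfv _ hmem
      rw [sub_right_comm, inner_sub_right, inner_smul_right, real_inner_self_eq_norm_sq] at this
      have e : θ * ρ / ‖v‖ * ‖v‖ ^ 2 = θ * (ρ * ‖v‖) := by field_simp
      linarith
    have h2 := h1 0 le_rfl one_pos
    rw [zero_mul] at h2
    have h3 : 0 < ρ * ‖v‖ := by positivity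
    have := h1 (inner ℝ v (c - q) / (ρ * ‖v‖)) (by positivity) ((div_lt_one h3).2 hlt)
    rw [div_mul_cancel₀ _ h3.ne'] at this
    exact lt_irrefl _ this
  have heq : inner ℝ v (c - q) = ‖v‖ * ‖c - q‖ :=
    le_antisymm (real_inner_le_norm _ _) (by rw [mul_comm]; exact hge)
  have hpar := inner_eq_norm_mul_iff_real.1 heq
  have h1 : ‖v‖ * inner ℝ (c - q) (y - q) = ρ * inner ℝ v (y - q) := by
    rw [← real_inner_smul_left, ← real_inner_smul_left, hpar]
  have h2 := hfv y hy
  have : 0 < ‖v‖ * inner ℝ (c - q) (y - q) := by rw [h1]; positivity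
  exact pos_of_mul_pos_right this hvn.le

/-- The unit vector `n` is the inner normal of `D` at `p`: `D` lies in the half-space cut out by
the tangent plane at `p`, and contains a ball of radius `r` touching this plane at `p`. -/
structure IsInnerNormal (D : Set E3) (r : ℝ) (p n : E3) : Prop where
  norm_eq : ‖n‖ = 1
  notMem : p ∉ D
  inner_pos : ∀ y ∈ D, 0 < inner ℝ n (y - p)
  ball_subset : Metric.ball (p + r • n) r ⊆ D

theorem exists_nearest_frontier {D : Set E3} (hDo : IsOpen D) (hne : (Dᶜ).Nonempty) {x : E3}
    (hx : x ∈ D) : ∃ p ∈ frontier D, 0 < ‖x - p‖ ∧ Metric.infDist x Dᶜ = ‖x - p‖ ∧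
      Metric.ball x ‖x - p‖ ⊆ D := by
  obtain ⟨p, hp, hd⟩ := hDo.isClosed_compl.exists_infDist_eq_dist hne x
  rw [dist_eq_norm] at hd
  have hpos : 0 < ‖x - p‖ := norm_pos_iff.2 (sub_ne_zero.2 fun h => hp (h ▸ hx))
  have hball : Metric.ball x ‖x - p‖ ⊆ D := fun y hy => by
    by_contra hyD
    have := Metric.infDist_le_dist_of_mem (x := x) (show y ∈ Dᶜ from hyD)
    rw [hd, dist_comm] at this
    exact absurd (Metric.mem_ball.1 hy) (not_lt.2 this)
  refine ⟨p, ?_, hpos, hd, hball⟩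
  rw [frontier, hDo.interior_eq]
  refine ⟨closure_mono hball ?_, hp⟩
  rw [closure_ball x hpos.ne', Metric.mem_closedBall, dist_comm, dist_eq_norm]

/-- A `C^2` graph domain has a uniform interior ball at each boundary point. -/
theorem IsC2HolderDomain.exists_interior_ball {α : ℝ} {D : Set E3} (h : IsC2HolderDomain α D) :
    ∃ r > 0, ∀ p ∈ frontier D, ∃ ν : E3, ‖ν‖ = 1 ∧ Metric.ball (p + r • ν) r ⊆ D := by
  obtain ⟨r, hr, K, hK⟩ := h
  have hk : 0 < 2 * (|K| + 1) := by positivity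
  -- A point `u` of the ball satisfies `|u.fst|² ≤ 2 r₀ u.snd`, while `w` lies below the paraboloid
  -- `|K| |v|²`. The choice makes `2 r₀ |K| < 1`, so the ball is above the graph; `r / 2` keeps it
  -- inside the chart.
  set r₀ : ℝ := min (r / 2) (1 / (2 * (|K| + 1))) with hr₀
  have hr₀pos : 0 < r₀ := lt_min (by linarith) (by positivity)
  have hr₀r : r₀ ≤ r / 2 := min_le_left _ _
  have hr₀K : r₀ * (2 * (|K| + 1)) ≤ 1 := (le_div_iff₀ hk).1 (min_le_right _ _)
  refine ⟨r₀, hr₀pos, fun p hp => ?_⟩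
  obtain ⟨e, w, hw, hw0, hdw0, hbd, -, hgraph⟩ := hK p hp
  have hquad : ∀ v ∈ Metric.ball (0 : E2) r, w v ≤ |K| * ‖v‖ ^ 2 := by
    intro v hv
    have hdiff : ∀ u ∈ Metric.ball (0 : E2) r, ContDiffAt ℝ 2 w u := fun u hu =>
      hw.contDiffAt (Metric.isOpen_ball.mem_nhds hu)
    have h1 : ∀ u ∈ Metric.ball (0 : E2) r, ‖fderiv ℝ w u‖ ≤ |K| * ‖u‖ := fun u hu => by
      have := (convex_ball (0 : E2) r).norm_image_sub_le_of_norm_fderiv_le (f := fderiv ℝ w)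
        (C := |K|) (fun z hz => ((hdiff z hz).fderiv_right (m := 1) (by norm_num)).differentiableAt
          (by norm_num)) (fun z hz => by
          rw [norm_fderiv_fderiv]; exact (hbd z hz).trans (le_abs_self K))
        (Metric.mem_ball_self hr) hu
      simpa [hdw0] using this
    have hsub : Metric.closedBall (0 : E2) ‖v‖ ⊆ Metric.ball 0 r :=
      Metric.closedBall_subset_ball (mem_ball_zero_iff.1 hv)
    have := (convex_closedBall (0 : E2) ‖v‖).norm_image_sub_le_of_norm_fderiv_le (f := w)
      (C := |K| * ‖v‖) (fun z hz => (hdiff z (hsub hz)).differentiableAt (by norm_num))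
      (fun z hz => (h1 z (hsub hz)).trans (by
        gcongr; exact mem_closedBall_zero_iff.1 hz))
      (Metric.mem_closedBall_self (norm_nonneg v)) (mem_closedBall_zero_iff.2 le_rfl)
    rw [hw0, sub_zero, sub_zero, Real.norm_eq_abs] at this
    calc w v ≤ |w v| := le_abs_self _
      _ ≤ _ := this
      _ = _ := by ring
  have h3 : ‖(WithLp.toLp 2 ((0 : E2), (1 : ℝ)) : WithLp 2 (E2 × ℝ))‖ = 1 := by
    rw [WithLp.prod_norm_eq_of_L2]; simp
  refine ⟨e.symm (WithLp.toLp 2 (0, 1)), by rw [e.symm.norm_map, h3], fun x hx => ?_⟩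
  rw [mem_ball_iff_norm] at hx
  have hxp : ‖x - p‖ < r := by
    have : ‖x - p‖ ≤ ‖x - (p + r₀ • e.symm (WithLp.toLp 2 (0, 1)))‖
        + ‖r₀ • e.symm (WithLp.toLp 2 ((0 : E2), (1 : ℝ)))‖ := by
      refine le_trans (le_of_eq ?_) (norm_add_le _ _)
      congr 1; abel
    rw [norm_smul, e.symm.norm_map, h3, Real.norm_eq_abs, abs_of_pos hr₀pos] at this
    linarith
  refine (hgraph x (mem_ball_iff_norm.2 hxp)).2 ?_
  have hu : ‖e (x - p) - r₀ • WithLp.toLp 2 ((0 : E2), (1 : ℝ))‖ < r₀ := by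
    have : e (x - (p + r₀ • e.symm (WithLp.toLp 2 ((0 : E2), (1 : ℝ)))))
        = e (x - p) - r₀ • WithLp.toLp 2 ((0 : E2), (1 : ℝ)) := by
      rw [← sub_sub, map_sub, map_smul, e.apply_symm_apply]
    rwa [← this, e.norm_map]
  set u := e (x - p) with hue
  have hsq := WithLp.prod_norm_sq_eq_of_L2 (u - r₀ • WithLp.toLp 2 ((0 : E2), (1 : ℝ)))
  simp only [WithLp.sub_fst, WithLp.sub_snd, WithLp.smul_fst, WithLp.smul_snd,
    smul_eq_mul, Real.norm_eq_abs, sq_abs] at hsq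
  have hf0 : (WithLp.toLp 2 ((0 : E2), (1 : ℝ)) : WithLp 2 (E2 × ℝ)).fst = 0 := rfl
  have hs1 : (WithLp.toLp 2 ((0 : E2), (1 : ℝ)) : WithLp 2 (E2 × ℝ)).snd = 1 := rfl
  rw [hf0, hs1, smul_zero, sub_zero, mul_one] at hsq
  have hlt : ‖u.fst‖ ^ 2 + (u.snd - r₀) ^ 2 < r₀ ^ 2 := by
    rw [← hsq]; gcongr
  have hsnd : 0 < u.snd := by nlinarith [sq_nonneg u.snd, sq_nonneg ‖u.fst‖]
  have hfst : ‖u.fst‖ < r := by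
    have : ‖u.fst‖ < r₀ := by
      refine lt_of_pow_lt_pow_left₀ 2 hr₀pos.le ?_
      nlinarith [sq_nonneg (u.snd - r₀)]
    linarith
  have hw1 := hquad u.fst (mem_ball_zero_iff.2 hfst)
  have hK0 := abs_nonneg K
  have a1 : ‖u.fst‖ ^ 2 ≤ 2 * r₀ * u.snd := by nlinarith [sq_nonneg u.snd]
  have a2 : |K| * ‖u.fst‖ ^ 2 ≤ |K| * (2 * r₀ * u.snd) := by gcongr
  have a3 : 0 < (1 - 2 * r₀ * |K|) * u.snd := by
    apply mul_pos _ hsnd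
    nlinarith
  nlinarith

/-- The second assertion is uniqueness of the normal: the ball about `x` may be much smaller than
`r`, but its direction agrees with that of the uniform interior ball, so radius `r` is available
along the segment to the nearest point. -/
theorem exists_isInnerNormal {α : ℝ} {D : Set E3} (hDo : IsOpen D) (hDc : Convex ℝ D)
    (h : IsC2HolderDomain α D) :
    ∃ r > 0, (∀ p ∈ frontier D, ∃ n, IsInnerNormal D r p n) ∧
      ∀ x ∈ D, ∀ p ∉ D, 0 < ‖x - p‖ → Metric.ball x ‖x - p‖ ⊆ D → p ∈ frontier D →
        IsInnerNormal D r p (‖x - p‖⁻¹ • (x - p)) := by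
  obtain ⟨r, hr, hball⟩ := h.exists_interior_ball
  have hfr : ∀ p ∈ frontier D, ∃ n, IsInnerNormal D r p n := fun p hp => by
    obtain ⟨ν, hν, hb⟩ := hball p hp
    have hpD : p ∉ D := by
      rw [frontier, hDo.interior_eq] at hp; exact hp.2
    refine ⟨ν, hν, hpD, fun y hy => ?_, hb⟩
    have e1 : p + r • ν - p = r • ν := add_sub_cancel_left _ _
    have e2 : ‖p + r • ν - p‖ = r := by
      rw [e1, norm_smul, hν, mul_one, Real.norm_eq_abs, abs_of_pos hr]
    have := inner_pos_of_ball_subset hDo hDc hpD (c := p + r • ν)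
      (fun h => by rw [h, sub_self, norm_zero] at e2; exact hr.ne e2) (by rw [e2]; exact hb) hy
    rw [e1, inner_smul_left] at this
    exact pos_of_mul_pos_right (by simpa using this) hr.le
  refine ⟨r, hr, hfr, fun x hx p hp hpos hb hpf => ?_⟩
  obtain ⟨ν, hν⟩ := hfr p hpf
  set m : E3 := ‖x - p‖⁻¹ • (x - p) with hm
  have hm1 : ‖m‖ = 1 := by rw [hm, norm_smul, norm_inv, norm_norm, inv_mul_cancel₀ hpos.ne']
  have hmpos : ∀ y ∈ D, 0 < inner ℝ m (y - p) := fun y hy => by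
    rw [hm, inner_smul_left]
    exact mul_pos (by simpa using hpos)
      (inner_pos_of_ball_subset hDo hDc hp (fun h => by simp [h] at hpos) hb hy)
  -- The ball centred at `p + r ν` lies in the half-space with normal `m`, which forces `⟨m, ν⟩ ≥ 1`
  -- for these unit vectors.
  have hle : ∀ θ : ℝ, 0 < θ → θ < 1 → θ ≤ inner ℝ m ν := fun θ h0 h1 => by
    have hmem : p + r • ν - (θ * r) • m ∈ D := hν.ball_subset (by
      rw [mem_ball_iff_norm, sub_sub_cancel_left, norm_neg, norm_smul, hm1, Real.norm_eq_abs,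
        abs_of_pos (by positivity)]
      nlinarith)
    have := hmpos _ hmem
    rw [show p + r • ν - (θ * r) • m - p = r • ν - (θ * r) • m by abel, inner_sub_right,
      inner_smul_right, inner_smul_right, real_inner_self_eq_norm_sq, hm1] at this
    have : r * θ < r * inner ℝ m ν := by linarith
    exact (lt_of_mul_lt_mul_left this hr.le).le
  have hge : 1 ≤ inner ℝ m ν := by
    by_contra! hlt
    have h1 := hle (max (1 / 2) ((1 + inner ℝ m ν) / 2)) (by positivity)
      (max_lt (by norm_num) (by linarith))
    have := le_max_right (1 / 2) ((1 + inner ℝ m ν) / 2)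
    linarith
  have : ‖m - ν‖ ^ 2 ≤ 0 := by
    rw [norm_sub_sq_real, hm1, hν.norm_eq]; linarith
  have hmν : m = ν := by
    rw [← sub_eq_zero, ← norm_eq_zero]
    exact pow_eq_zero_iff two_ne_zero |>.1 (le_antisymm this (sq_nonneg _))
  rwa [hmν]

/-- Where it is differentiable, the distance function has gradient pointing away from the nearest
boundary point. -/
theorem gradient_extendedDist {D : Set E3} (hDo : IsOpen D) {x p : E3} (hx : x ∈ D) (hp : p ∉ D)
    (hpos : 0 < ‖x - p‖) (hdist : Metric.infDist x Dᶜ = ‖x - p‖)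
    (hd : DifferentiableAt ℝ (extendedDist D) x) :
    gradient (extendedDist D) x = ‖x - p‖⁻¹ • (x - p) := by
  set n : E3 := ‖x - p‖⁻¹ • (x - p) with hn
  have hn1 : ‖n‖ = 1 := by rw [hn, norm_smul, norm_inv, norm_norm, inv_mul_cancel₀ hpos.ne']
  set φ : E3 → ℝ := fun y => Metric.infDist y Dᶜ with hφ
  have heq : extendedDist D =ᶠ[𝓝 x] φ := by
    filter_upwards [hDo.mem_nhds hx] with y hy
    simp [extendedDist, hy, hφ]
  have hdφ : DifferentiableAt ℝ φ x := hd.congr_of_eventuallyEq heq.symm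
  have hgr : gradient (extendedDist D) x = gradient φ x := by
    rw [gradient, gradient, heq.fderiv_eq]
  have hle : ‖gradient φ x‖ ≤ 1 := by
    rw [gradient, LinearIsometryEquiv.norm_map]
    simpa using norm_fderiv_le_of_lipschitz ℝ (Metric.lipschitz_infDist_pt Dᶜ) (x₀ := x)
  have hfd : fderiv ℝ φ x n = inner ℝ (gradient φ x) n := by
    rw [gradient, InnerProductSpace.toDual_symm_apply]
  have hline : HasDerivAt (fun t : ℝ => φ (x + t • (-n))) (-(inner ℝ (gradient φ x) n)) 0 := by
    have hl : HasDerivAt (fun t : ℝ => x + t • (-n)) (-n) 0 := by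
      simpa using ((hasDerivAt_id (0 : ℝ)).smul_const (-n)).const_add x
    have h0 : DifferentiableAt ℝ φ (x + (0 : ℝ) • (-n)) := by simpa using hdφ
    refine (h0.hasFDerivAt.comp_hasDerivAt (0 : ℝ) hl).congr_deriv ?_
    rw [zero_smul, add_zero, map_neg, hfd]
  have hlim := hline.tendsto_slope.mono_left (nhdsGT_le_nhdsNE (0 : ℝ))
  have hsl : ∀ᶠ t : ℝ in 𝓝[>] 0, slope (fun t : ℝ => φ (x + t • (-n))) 0 t ≤ -1 := by
    filter_upwards [self_mem_nhdsWithin, nhdsWithin_le_nhds (gt_mem_nhds hpos)] with t ht htR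
    have ht' : 0 < t := ht
    have h1 : φ (x + t • (-n)) ≤ ‖x - p‖ - t := by
      have h2 := Metric.infDist_le_dist_of_mem (x := x + t • (-n)) (show p ∈ Dᶜ from hp)
      have h3 : x + t • (-n) - p = (‖x - p‖ - t) • n := by
        rw [sub_smul, hn, smul_inv_smul₀ hpos.ne']; simp; abel
      rwa [dist_eq_norm, h3, norm_smul, hn1, mul_one, Real.norm_eq_abs,
        abs_of_pos (by linarith)] at h2
    rw [slope_def_field]
    simp only [zero_smul, add_zero, sub_zero]
    rw [div_le_iff₀ ht']
    have : φ x = ‖x - p‖ := hdist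
    linarith
  have h1 := le_of_tendsto hlim hsl
  -- The gradient has norm at most `1` since the distance is 1-Lipschitz, and its component along
  -- `n` is at least `1`.
  have h2 : ‖gradient φ x - n‖ ^ 2 ≤ 0 := by
    rw [norm_sub_sq_real, hn1]
    nlinarith [norm_nonneg (gradient φ x)]
  rw [hgr, ← sub_eq_zero, ← norm_eq_zero]
  exact pow_eq_zero_iff two_ne_zero |>.1 (le_antisymm h2 (sq_nonneg _))

/-! ### The Dirichlet problem. -/

/-- `f` solves the Dirichlet problem for the Laplacian on `D` with boundary values `φ`, and decays
at infinity. -/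
structure IsDirichletSolution (D : Set E3) (φ f : E3 → ℝ) : Prop where
  differentiableAt : ∀ x ∈ D, DifferentiableAt ℝ f x
  diffHarmonicAt : ∀ x ∈ D, DiffHarmonicAt f x
  boundary : ∀ z ∈ frontier D, Tendsto f (𝓝[D] z) (𝓝 (φ z))
  infinity : Tendsto f (Bornology.cobounded E3 ⊓ 𝓟 D) (𝓝 0)

namespace IsDirichletSolution

variable {D : Set E3} {φ ψ f g : E3 → ℝ}

theorem continuousOn (hf : IsDirichletSolution D φ f) : ContinuousOn f D := fun x hx =>
  (hf.differentiableAt x hx).continuousAt.continuousWithinAt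

theorem add (hf : IsDirichletSolution D φ f) (hg : IsDirichletSolution D ψ g) :
    IsDirichletSolution D (fun z => φ z + ψ z) (fun x => f x + g x) where
  differentiableAt x hx := (hf.differentiableAt x hx).add (hg.differentiableAt x hx)
  diffHarmonicAt x hx := (hf.diffHarmonicAt x hx).add (hg.diffHarmonicAt x hx)
  boundary z hz := (hf.boundary z hz).add (hg.boundary z hz)
  infinity := by simpa using hf.infinity.add hg.infinity

theorem const_mul (hf : IsDirichletSolution D φ f) (c : ℝ) :
    IsDirichletSolution D (fun z => c * φ z) (fun x => c * f x) where
  differentiableAt x hx := (hf.differentiableAt x hx).const_mul c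
  diffHarmonicAt x hx := (hf.diffHarmonicAt x hx).const_mul c
  boundary z hz := (hf.boundary z hz).const_mul c
  infinity := by simpa using hf.infinity.const_mul c

theorem sub (hf : IsDirichletSolution D φ f) (hg : IsDirichletSolution D ψ g) :
    IsDirichletSolution D (fun z => φ z - ψ z) (fun x => f x - g x) := by
  simpa [sub_eq_add_neg] using hf.add (hg.const_mul (-1))

theorem le (hf : IsDirichletSolution D φ f) (hD : IsOpen D) {M : ℝ} (hM0 : 0 ≤ M)
    (hM : ∀ z ∈ frontier D, φ z ≤ M) {x : E3} (hx : x ∈ D) : f x ≤ M := by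
  have := diffHarmonic_le_zero hD (f := fun x => f x - M)
    (hf.continuousOn.sub continuousOn_const)
    (fun y hy => (hf.diffHarmonicAt y hy).sub (diffHarmonicAt_const M y))
    (fun z hz ε hε => by
      filter_upwards [(hf.boundary z hz).eventually
        (gt_mem_nhds (lt_add_of_pos_right (φ z) hε))] with y hy
      linarith [hM z hz])
    (fun ε hε => by
      filter_upwards [hf.infinity.eventually (gt_mem_nhds hε)] with y hy
      linarith) x hx
  linarith

theorem abs_le (hf : IsDirichletSolution D φ f) (hD : IsOpen D) {M : ℝ} (hM0 : 0 ≤ M)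
    (hM : ∀ z ∈ frontier D, |φ z| ≤ M) {x : E3} (hx : x ∈ D) : |f x| ≤ M := by
  have h1 := hf.le hD hM0 (fun z hz => (le_abs_self _).trans (hM z hz)) hx
  have h2 := (hf.const_mul (-1)).le hD hM0
    (fun z hz => (by linarith [neg_abs_le (φ z)] : -1 * φ z ≤ |φ z|).trans (hM z hz)) hx
  exact _root_.abs_le.2 ⟨by linarith, h1⟩

end IsDirichletSolution

theorem norm_gradient_eq (f : E3 → ℝ) (x : E3) : ‖gradient f x‖ = ‖fderiv ℝ f x‖ := by
  rw [gradient, LinearIsometryEquiv.norm_map]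

/-- The gradient at an interior point is controlled by the supremum of the boundary data. Applied to
combinations of solutions with different poles, this transfers regularity in the pole from the
explicit data to the solution. -/
theorem IsDirichletSolution.norm_fderiv_le {D : Set E3} {φ f : E3 → ℝ}
    (hf : IsDirichletSolution D φ f) (hD : IsOpen D) {M : ℝ} (hM0 : 0 ≤ M)
    (hM : ∀ z ∈ frontier D, |φ z| ≤ M) {x : E3} {ρ : ℝ} (hρ : 0 < ρ)
    (hball : Metric.ball x ρ ⊆ D) : ‖fderiv ℝ f x‖ ≤ 3 * M / ρ := by
  rw [← norm_gradient_eq]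
  exact norm_gradient_le_of_diffHarmonic hρ (hf.continuousOn.mono hball)
    (fun y hy => hf.diffHarmonicAt y (hball hy)) (fun y hy => hf.abs_le hD hM0 hM (hball hy))
    (hf.differentiableAt x (hball (Metric.mem_ball_self hρ)))

/-! ### The regular part of the Green function and its dependence on the pole. -/

/-- `H y` is the regular part of `4π` times the Green function of `D` with pole `y`. -/
def IsRegularPart (D : Set E3) (H : E3 → E3 → ℝ) : Prop :=
  ∀ y ∈ D, IsDirichletSolution D (fun z => ‖z - y‖⁻¹) (H y)

theorem tendsto_inv_norm_sub_cobounded (a : E3) :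
    Tendsto (fun x : E3 => ‖x - a‖⁻¹) (Bornology.cobounded E3) (𝓝 0) := by
  refine tendsto_inv_atTop_zero.comp ?_
  have h1 : Tendsto (fun x : E3 => ‖x‖ - ‖a‖) (Bornology.cobounded E3) atTop :=
    tendsto_atTop_add_const_right _ _ tendsto_norm_cobounded_atTop
  exact tendsto_atTop_mono (fun x => norm_sub_norm_le x a) h1

theorem continuousAt_inv_norm_sub {x y : E3} (hxy : x ≠ y) :
    ContinuousAt (fun x => ‖x - y‖⁻¹) x :=
  ContinuousAt.inv₀ (by fun_prop) (norm_ne_zero_iff.2 (sub_ne_zero.2 hxy))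

theorem IsDirichletGreenFunction.exists_isRegularPart {D : Set E3} {G : E3 → E3 → ℝ}
    (hD : IsOpen D) (hG : IsDirichletGreenFunction D G) :
    ∃ H : E3 → E3 → ℝ, IsRegularPart D H ∧
      (∀ y ∈ D, ∀ x ∈ D, ContDiffAt ℝ 2 (H y) x) ∧
      ∀ y ∈ D, ∀ x ∈ D, x ≠ y → G x y = (4 * Real.pi)⁻¹ * (H y x - ‖x - y‖⁻¹) := by
  choose! h hh hGh using hG.harmonic_part
  have hG' : ∀ y ∈ D, ∀ x ∈ D, x ≠ y →
      G x y = (4 * Real.pi)⁻¹ * (4 * Real.pi * h y x - ‖x - y‖⁻¹) := fun y hy x hx hxy => by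
    have : ‖x - y‖ ≠ 0 := norm_ne_zero_iff.2 (sub_ne_zero.2 hxy)
    have := Real.pi_ne_zero
    rw [hGh y hy x hx hxy]
    field_simp
    ring
  have hG'' : ∀ y ∈ D, ∀ x ∈ D, x ≠ y →
      4 * Real.pi * h y x = 4 * Real.pi * G x y + ‖x - y‖⁻¹ := fun y hy x hx hxy => by
    have := Real.pi_ne_zero
    rw [hG' y hy x hx hxy]
    field_simp
    ring
  refine ⟨fun y x => 4 * Real.pi * h y x, fun y hy => ⟨fun x hx => ?_, fun x hx => ?_,
    fun z hz => ?_, ?_⟩, fun y hy x hx => ?_, hG'⟩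
  · exact ((hh y hy x hx).1.differentiableAt (by norm_num)).const_mul _
  · exact (hh y hy x hx).diffHarmonicAt.const_mul _
  · have hzD : z ∉ D := by
      rw [frontier, hD.interior_eq] at hz; exact hz.2
    have hzy : z ≠ y := fun h => hzD (h ▸ hy)
    have h1 := ((hG.boundary y hy z hz).const_mul (4 * Real.pi)).add
      ((continuousAt_inv_norm_sub hzy).tendsto.mono_left nhdsWithin_le_nhds)
    rw [mul_zero, zero_add] at h1
    refine h1.congr' ?_
    filter_upwards [self_mem_nhdsWithin, nhdsWithin_le_nhds (isOpen_ne.mem_nhds hzy)] with x hx hxy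
    exact (hG'' y hy x hx hxy).symm
  · have h1 := ((hG.infinity y hy).const_mul (4 * Real.pi)).add
      ((tendsto_inv_norm_sub_cobounded y).mono_left inf_le_left)
    rw [mul_zero, zero_add] at h1
    refine h1.congr' ?_
    have hne : ∀ᶠ x in Bornology.cobounded E3, x ≠ y := by
      filter_upwards [Bornology.isBounded_def.1 (Bornology.isBounded_singleton (x := y))] with x hx
      exact hx
    filter_upwards [hne.filter_mono inf_le_left,
      (mem_inf_of_right (mem_principal_self D) : D ∈ Bornology.cobounded E3 ⊓ 𝓟 D)] with x hx hxD
    exact (hG'' y hy x hxD hx).symm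
  · exact contDiffAt_const.mul (hh y hy x hx).1

theorem notMem_of_mem_frontier {D : Set E3} (hD : IsOpen D) {z : E3} (hz : z ∈ frontier D) :
    z ∉ D := by
  rw [frontier, hD.interior_eq] at hz; exact hz.2

theorem IsInnerNormal.inner_nonneg {D : Set E3} {r : ℝ} {p n z : E3} (hn : IsInnerNormal D r p n)
    (hz : z ∈ closure D) : 0 ≤ inner ℝ n (z - p) := by
  have : closure D ⊆ {z | 0 ≤ inner ℝ n (z - p)} :=
    closure_minimal (fun y hy => (hn.inner_pos y hy).le)
      (isClosed_le continuous_const (by fun_prop))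
  exact this hz

theorem IsInnerNormal.reflection_notMem {D : Set E3} {r : ℝ} {p n y : E3}
    (hn : IsInnerNormal D r p n) (hy : y ∈ D) : planeReflection p n y ∉ D := fun h => by
  have h1 := hn.inner_pos _ h
  have h2 := hn.inner_pos _ hy
  rw [planeReflection, sub_right_comm, inner_sub_right, inner_smul_right,
    real_inner_self_eq_norm_sq, hn.norm_eq] at h1
  linarith

theorem IsInnerNormal.norm_sub_le_norm_sub_reflection {D : Set E3} {r : ℝ} {p n y z : E3}
    (hn : IsInnerNormal D r p n) (hy : y ∈ D) (hz : z ∈ closure D) :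
    ‖z - y‖ ≤ ‖z - planeReflection p n y‖ := by
  refine le_of_sq_le_sq ?_ (norm_nonneg _)
  rw [norm_sub_rev z (planeReflection p n y), planeReflection_sub_self_sq p y z hn.norm_eq,
    norm_sub_rev z y]
  have := mul_nonneg (hn.inner_pos y hy).le (hn.inner_nonneg hz)
  linarith

namespace IsRegularPart

variable {D : Set E3} {H : E3 → E3 → ℝ}

/-- This is the sign `G ≤ 0`, by the maximum principle on the punctured domain; at the puncture the
difference tends to `-∞`. -/
theorem le_inv_norm (hH : IsRegularPart D H) (hD : IsOpen D) {x y : E3} (hx : x ∈ D) (hy : y ∈ D)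
    (hxy : x ≠ y) : H y x ≤ ‖x - y‖⁻¹ := by
  have hUo : IsOpen (D \ {y}) := hD.sdiff isClosed_singleton
  have := diffHarmonic_le_zero hUo (f := fun x => H y x - ‖x - y‖⁻¹)
    (fun x hx => (((hH y hy).continuousOn.continuousAt (hD.mem_nhds hx.1)).sub
      (continuousAt_inv_norm_sub hx.2)).continuousWithinAt)
    (fun x hx => ((hH y hy).diffHarmonicAt x hx.1).sub (diffHarmonicAt_inv_norm hx.2))
    (fun z hz ε hε => by
      rw [frontier, hUo.interior_eq] at hz
      by_cases hzD : z ∈ D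
      · have hzy : z = y := by
          by_contra h; exact hz.2 ⟨hzD, h⟩
        subst hzy
        have hc := (hH z hy).continuousOn.continuousAt (hD.mem_nhds hy)
        have hB : 0 < |H z z| + 1 := by positivity
        filter_upwards [self_mem_nhdsWithin, nhdsWithin_le_nhds
          (hc.eventually (gt_mem_nhds (by linarith [le_abs_self (H z z)] : H z z < |H z z| + 1))),
          nhdsWithin_le_nhds (Metric.ball_mem_nhds z (inv_pos.2 hB))] with x hxU hx1 hx2
        rw [mem_ball_iff_norm] at hx2
        have h0 : 0 < ‖x - z‖ := norm_pos_iff.2 (sub_ne_zero.2 hxU.2)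
        have := (lt_inv_comm₀ h0 hB).1 hx2
        linarith
      · have hzf : z ∈ frontier D := by
          rw [frontier, hD.interior_eq]
          exact ⟨closure_mono Set.sdiff_subset hz.1, hzD⟩
        have hzy : z ≠ y := fun h => hzD (h ▸ hy)
        have h1 := ((hH y hy).boundary z hzf).sub
          ((continuousAt_inv_norm_sub hzy).tendsto.mono_left nhdsWithin_le_nhds)
        rw [sub_self] at h1
        exact (h1.eventually (gt_mem_nhds hε)).filter_mono (nhdsWithin_mono z Set.sdiff_subset))
    (fun ε hε => by
      have h1 := (hH y hy).infinity.sub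
        ((tendsto_inv_norm_sub_cobounded y).mono_left inf_le_left)
      rw [sub_zero] at h1
      exact (h1.eventually (gt_mem_nhds hε)).filter_mono
        (inf_le_inf_left _ (principal_mono.2 Set.sdiff_subset))) x ⟨hx, hxy⟩
  linarith

/-- `D` lies in the half-space at `p`, so the Green function of `D` is at least the half-space one.
Boundary points of `D` are no farther from `y` than from its mirror image, which orders the boundary
data. -/
theorem inv_norm_reflection_le (hH : IsRegularPart D H) (hD : IsOpen D) {r : ℝ} {p n x y : E3}
    (hn : IsInnerNormal D r p n) (hx : x ∈ D) (hy : y ∈ D) :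
    ‖x - planeReflection p n y‖⁻¹ ≤ H y x := by
  set y' := planeReflection p n y with hy'
  have hy'D : y' ∉ D := hn.reflection_notMem hy
  have hne : ∀ z ∈ closure D, z ≠ y' := fun z hz h => by
    have h1 := hn.inner_pos _ hy
    have h2 := hn.inner_nonneg hz
    rw [h, hy', planeReflection, sub_right_comm, inner_sub_right, inner_smul_right,
      real_inner_self_eq_norm_sq, hn.norm_eq] at h2
    linarith
  have := diffHarmonic_le_zero hD (f := fun x => ‖x - y'‖⁻¹ - H y x)
    (fun x hx => (((continuousAt_inv_norm_sub (hne x (subset_closure hx))).sub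
      ((hH y hy).continuousOn.continuousAt (hD.mem_nhds hx)))).continuousWithinAt)
    (fun x hx => (diffHarmonicAt_inv_norm (hne x (subset_closure hx))).sub
      ((hH y hy).diffHarmonicAt x hx))
    (fun z hz ε hε => by
      have hzc := frontier_subset_closure hz
      have h1 := ((continuousAt_inv_norm_sub (hne z hzc)).tendsto.mono_left
        nhdsWithin_le_nhds).sub ((hH y hy).boundary z hz)
      refine h1.eventually (gt_mem_nhds (lt_of_le_of_lt ?_ hε))
      have hzy : z ≠ y := fun h => notMem_of_mem_frontier hD hz (h ▸ hy)
      have : ‖z - y'‖⁻¹ ≤ ‖z - y‖⁻¹ :=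
        inv_anti₀ (norm_pos_iff.2 (sub_ne_zero.2 hzy)) (hn.norm_sub_le_norm_sub_reflection hy hzc)
      linarith)
    (fun ε hε => by
      have h1 := ((tendsto_inv_norm_sub_cobounded y').mono_left inf_le_left).sub
        (hH y hy).infinity
      rw [sub_zero] at h1
      exact h1.eventually (gt_mem_nhds hε)) x hx
  linarith

/-- The Green function decays linearly as the pole approaches the boundary. -/
theorem abs_sub_inv_norm_le (hH : IsRegularPart D H) (hD : IsOpen D) {r : ℝ} {p n x y : E3}
    (hn : IsInnerNormal D r p n) (hx : x ∈ D) (hy : y ∈ D) (hxy : x ≠ y) :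
    |H y x - ‖x - y‖⁻¹| ≤ 2 * ‖y - p‖ / ‖x - y‖ ^ 2 := by
  have h1 := hH.le_inv_norm hD hx hy hxy
  have h2 := hH.inv_norm_reflection_le hD hn hx hy
  have h3 := hn.norm_sub_le_norm_sub_reflection hy (subset_closure hx)
  set y' := planeReflection p n y with hy'
  have hd : 0 < ‖x - y‖ := norm_pos_iff.2 (sub_ne_zero.2 hxy)
  have hd' : 0 < ‖x - y'‖ := hd.trans_le h3
  have h4 : ‖x - y'‖ ≤ ‖x - y‖ + 2 * ‖y - p‖ := by
    have e1 : x - y' = (x - y) + (2 * inner ℝ n (y - p)) • n := by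
      rw [hy', planeReflection]; abel
    have e2 : |inner ℝ n (y - p)| ≤ ‖y - p‖ := by
      simpa [hn.norm_eq] using abs_real_inner_le_norm n (y - p)
    rw [e1]
    refine (norm_add_le _ _).trans ?_
    rw [norm_smul, hn.norm_eq, mul_one, Real.norm_eq_abs, abs_mul, Nat.abs_ofNat]
    linarith
  rw [abs_of_nonpos (by linarith)]
  have h5 : ‖x - y‖⁻¹ - ‖x - y'‖⁻¹ ≤ 2 * ‖y - p‖ / ‖x - y‖ ^ 2 := by
    rw [inv_sub_inv hd.ne' hd'.ne']
    gcongr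
    · linarith
    · nlinarith
  linarith

theorem abs_sub_inv_norm_le_inv (hH : IsRegularPart D H) (hD : IsOpen D) {r : ℝ} {p n x y : E3}
    (hn : IsInnerNormal D r p n) (hx : x ∈ D) (hy : y ∈ D) (hxy : x ≠ y) :
    |H y x - ‖x - y‖⁻¹| ≤ ‖x - y‖⁻¹ := by
  have h1 := hH.le_inv_norm hD hx hy hxy
  have h2 := hH.inv_norm_reflection_le hD hn hx hy
  have h3 : 0 ≤ ‖x - planeReflection p n y‖⁻¹ := by positivity
  rw [abs_of_nonpos (by linarith)]
  linarith

theorem norm_sub_ge_of_ball_subset {y z : E3} {σ : ℝ} (h : Metric.ball y σ ⊆ D) (hz : z ∉ D) :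
    σ ≤ ‖z - y‖ := by
  by_contra! hlt
  exact hz (h (mem_ball_iff_norm.2 hlt))

theorem norm_fderiv_sub_le (hH : IsRegularPart D H) (hD : IsOpen D) {x y y' : E3} {ρ σ : ℝ}
    (hρ : 0 < ρ) (hx : Metric.ball x ρ ⊆ D) (hσ : 0 < σ) (hy : Metric.ball y σ ⊆ D)
    (hy' : Metric.ball y' σ ⊆ D) :
    ‖fderiv ℝ (H y) x - fderiv ℝ (H y') x‖ ≤ 3 * (‖y - y'‖ / σ ^ 2) / ρ := by
  have hyD := hy (Metric.mem_ball_self hσ)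
  have hyD' := hy' (Metric.mem_ball_self hσ)
  have hxD := hx (Metric.mem_ball_self hρ)
  rw [← fderiv_fun_sub ((hH y hyD).differentiableAt x hxD) ((hH y' hyD').differentiableAt x hxD)]
  refine ((hH y hyD).sub (hH y' hyD')).norm_fderiv_le hD (by positivity) (fun z hz => ?_) hρ hx
  have hz' := notMem_of_mem_frontier hD hz
  have h1 := norm_sub_ge_of_ball_subset hy hz'
  have h2 := norm_sub_ge_of_ball_subset hy' hz'
  have h3 : |‖z - y'‖ - ‖z - y‖| ≤ ‖y - y'‖ := by
    refine (abs_norm_sub_norm_le _ _).trans (le_of_eq ?_)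
    congr 1; abel
  rw [inv_sub_inv (by linarith) (by linarith), abs_div, abs_of_pos (mul_pos (hσ.trans_le h1)
    (hσ.trans_le h2))]
  gcongr
  rw [pow_two]
  gcongr

/-- The discrete Laplacian in the pole is a finite linear combination of regular parts. As a
function of `x` it therefore solves the Dirichlet problem whose data is the discrete Laplacian of
`1/|z - y|`, small uniformly in `z`. -/
theorem norm_fderiv_diffLaplacian_le (hH : IsRegularPart D H) (hD : IsOpen D)
    (b : OrthonormalBasis (Fin 3) ℝ E3) {x y : E3} {h ρ σ : ℝ}
    (hρ : 0 < ρ) (hx : Metric.ball x ρ ⊆ D) (hh : 0 < h) (hσ : 2 * h ≤ σ)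
    (hy : Metric.ball y σ ⊆ D) (n : E3) (hn : ‖n‖ = 1) :
    |diffLaplacian b h (fun y => fderiv ℝ (H y) x n) y| ≤ 3 * (2304 * h / σ ^ 4) / ρ := by
  have hσ0 : 0 < σ := by linarith
  have hxD := hx (Metric.mem_ball_self hρ)
  have hyD := hy (Metric.mem_ball_self hσ0)
  have hmem : ∀ i, y + h • b i ∈ D ∧ y - h • b i ∈ D := fun i => by
    have hi : ‖h • b i‖ = h := by
      rw [norm_smul, b.orthonormal.1 i, mul_one, Real.norm_eq_abs, abs_of_pos hh]
    constructor <;> apply hy <;> rw [mem_ball_iff_norm]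
    · rw [add_sub_cancel_left, hi]; linarith
    · rw [sub_sub_cancel_left, norm_neg, hi]; linarith
  have hterm : ∀ i, IsDirichletSolution D
      (fun z => (‖z - (y + h • b i)‖⁻¹ + ‖z - (y - h • b i)‖⁻¹ - 2 * ‖z - y‖⁻¹) / h ^ 2)
      (fun x => (H (y + h • b i) x + H (y - h • b i) x - 2 * H y x) / h ^ 2) := fun i => by
    simpa only [div_eq_inv_mul] using
      (((hH _ (hmem i).1).add (hH _ (hmem i).2)).sub ((hH y hyD).const_mul 2)).const_mul
        ((h ^ 2)⁻¹)
  have hsol : IsDirichletSolution D (fun z => diffLaplacian b h (fun y => ‖z - y‖⁻¹) y)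
      (fun x => diffLaplacian b h (fun y => H y x) y) := by
    simp only [diffLaplacian, Fin.sum_univ_three]
    exact ((hterm 0).add (hterm 1)).add (hterm 2)
  have hfd : diffLaplacian b h (fun y => fderiv ℝ (H y) x n) y
      = fderiv ℝ (fun x => diffLaplacian b h (fun y => H y x) y) x n := by
    have hd : ∀ y ∈ D, HasFDerivAt (H y) (fderiv ℝ (H y) x) x := fun y hy =>
      ((hH y hy).differentiableAt x hxD).hasFDerivAt
    have := HasFDerivAt.fun_sum (u := Finset.univ) (fun (i : Fin 3) _ =>
      (((hd _ (hmem i).1).fun_add (hd _ (hmem i).2)).fun_sub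
        ((hd y hyD).const_mul 2)).mul_const ((h ^ 2)⁻¹))
    simp only [diffLaplacian, div_eq_mul_inv]
    rw [this.fderiv]
    simp only [sum_apply, smul_apply, sub_apply, add_apply, smul_eq_mul]
    exact Finset.sum_congr rfl fun i _ => by ring
  rw [hfd, ← Real.norm_eq_abs]
  refine (ContinuousLinearMap.le_opNorm _ _).trans ?_
  rw [hn, mul_one]
  refine hsol.norm_fderiv_le hD (by positivity) (fun z hz => ?_) hρ hx
  have h1 := norm_sub_ge_of_ball_subset hy (notMem_of_mem_frontier hD hz)
  simp only [norm_sub_rev z] at h1 ⊢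
  refine (abs_diffLaplacian_inv_norm_le b hh (hσ.trans h1)).trans ?_
  gcongr

theorem continuousOn_fderiv (hH : IsRegularPart D H) (hD : IsOpen D) {x : E3} (hx : x ∈ D)
    (n : E3) : ContinuousOn (fun y => fderiv ℝ (H y) x n) D := by
  obtain ⟨ρ, hρ, hxρ⟩ := Metric.isOpen_iff.1 hD x hx
  have : ContinuousOn (fun y => fderiv ℝ (H y) x) D := by
    intro y hy
    obtain ⟨σ, hσ, hyσ⟩ := Metric.isOpen_iff.1 hD y hy
    refine ContinuousAt.continuousWithinAt ?_
    rw [ContinuousAt, tendsto_iff_norm_sub_tendsto_zero]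
    have hlim : Tendsto (fun y' => 3 * (‖y' - y‖ / (σ / 2) ^ 2) / ρ) (𝓝 y) (𝓝 0) := by
      have : ContinuousAt (fun y' => 3 * (‖y' - y‖ / (σ / 2) ^ 2) / ρ) y := by fun_prop
      simpa using this.tendsto
    refine squeeze_zero' (Eventually.of_forall fun _ => norm_nonneg _) ?_ hlim
    filter_upwards [Metric.ball_mem_nhds y (half_pos hσ)] with y' hy'
    refine hH.norm_fderiv_sub_le hD hρ hxρ (half_pos hσ) ?_ ?_
    · refine (Metric.ball_subset_ball' ?_).trans hyσ
      linarith [Metric.mem_ball.1 hy']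
    · exact (Metric.ball_subset_ball (by linarith)).trans hyσ
  exact this.clm_apply continuousOn_const

theorem diffHarmonicAt_fderiv (hH : IsRegularPart D H) (hD : IsOpen D) {x y : E3} (hx : x ∈ D)
    (hy : y ∈ D) (n : E3) (hn : ‖n‖ = 1) : DiffHarmonicAt (fun y => fderiv ℝ (H y) x n) y := by
  obtain ⟨ρ, hρ, hxρ⟩ := Metric.isOpen_iff.1 hD x hx
  obtain ⟨σ, hσ, hyσ⟩ := Metric.isOpen_iff.1 hD y hy
  intro b
  have hlim : Tendsto (fun h : ℝ => 3 * (2304 * h / σ ^ 4) / ρ) (𝓝[>] 0) (𝓝 0) := by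
    have : ContinuousAt (fun h : ℝ => 3 * (2304 * h / σ ^ 4) / ρ) 0 := by fun_prop
    simpa using this.tendsto.mono_left nhdsWithin_le_nhds
  refine squeeze_zero_norm' ?_ hlim
  filter_upwards [self_mem_nhdsWithin,
    nhdsWithin_le_nhds (gt_mem_nhds (half_pos hσ))] with h hh hh2
  exact hH.norm_fderiv_diffLaplacian_le hD b hρ hxρ hh (by linarith) hyσ n hn

end IsRegularPart

/-! ### The slope of the Green function as a function of the pole. -/

/-- `4π` times the derivative of the Green function with regular part `H` at `x` in the direction
`n`, as a function of the pole `y`. -/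
noncomputable def greenSlope (H : E3 → E3 → ℝ) (n x y : E3) : ℝ :=
  fderiv ℝ (H y) x n - inner ℝ n (y - x) / ‖y - x‖ ^ 3

theorem differentiableAt_inv_norm_sub {x y : E3} (hxy : x ≠ y) :
    DifferentiableAt ℝ (fun x => ‖x - y‖⁻¹) x := by
  have h0 : x - y ≠ 0 := sub_ne_zero.2 hxy
  exact ((differentiableAt_id.sub_const y).norm ℝ h0).inv (norm_ne_zero_iff.2 h0)

theorem fderiv_inv_norm_sub {x y n : E3} (hxy : x ≠ y) (hn : ‖n‖ = 1) :
    fderiv ℝ (fun x => ‖x - y‖⁻¹) x n = inner ℝ n (y - x) / ‖y - x‖ ^ 3 := by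
  have hl : HasDerivAt (fun t : ℝ => x + t • n) n 0 := by
    simpa using ((hasDerivAt_id (0 : ℝ)).smul_const n).const_add x
  have hd : DifferentiableAt ℝ (fun x => ‖x - y‖⁻¹) (x + (0 : ℝ) • n) := by
    simpa using differentiableAt_inv_norm_sub hxy
  have h1 := hd.hasFDerivAt.comp_hasDerivAt (0 : ℝ) hl
  have h2 := hasDerivAt_inv_norm_line (u := x - y) hn (t := 0)
    (by simpa using sub_ne_zero.2 hxy)
  have h3 : (fun x => ‖x - y‖⁻¹) ∘ (fun t : ℝ => x + t • n)
      = fun t : ℝ => ‖x - y + t • n‖⁻¹ := by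
    ext t; simp only [Function.comp_def]; congr 2; abel
  rw [h3] at h1
  have h4 := h1.unique h2
  simp only [zero_smul, add_zero] at h4
  rw [h4, norm_sub_rev, ← neg_sub y x, inner_neg_left, real_inner_comm, neg_neg]

namespace IsRegularPart

variable {D : Set E3} {H : E3 → E3 → ℝ}

theorem differentiableAt_sub (hH : IsRegularPart D H) {x y : E3} (hx : x ∈ D) (hy : y ∈ D)
    (hxy : x ≠ y) : DifferentiableAt ℝ (fun x => H y x - ‖x - y‖⁻¹) x :=
  ((hH y hy).differentiableAt x hx).fun_sub (differentiableAt_inv_norm_sub hxy)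

theorem fderiv_sub_eq (hH : IsRegularPart D H) {x y n : E3} (hx : x ∈ D) (hy : y ∈ D)
    (hxy : x ≠ y) (hn : ‖n‖ = 1) :
    fderiv ℝ (fun x => H y x - ‖x - y‖⁻¹) x n = greenSlope H n x y := by
  rw [fderiv_fun_sub ((hH y hy).differentiableAt x hx) (differentiableAt_inv_norm_sub hxy),
    sub_apply, fderiv_inv_norm_sub hxy hn, greenSlope]

theorem abs_greenSlope_le (hH : IsRegularPart D H) {x y n : E3} (hn : ‖n‖ = 1) (hy : y ∈ D)
    {ρ M : ℝ} (hρ : 0 < ρ) (hx : Metric.ball x ρ ⊆ D) (hyρ : ρ ≤ ‖x - y‖)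
    (hM : ∀ x' ∈ Metric.ball x ρ, |H y x' - ‖x' - y‖⁻¹| ≤ M) :
    |greenSlope H n x y| ≤ 3 * M / ρ := by
  have hne : ∀ x' ∈ Metric.ball x ρ, x' ≠ y := fun x' hx' h => by
    rw [h, mem_ball_iff_norm, norm_sub_rev] at hx'
    linarith
  have hxx := Metric.mem_ball_self (x := x) hρ
  rw [← hH.fderiv_sub_eq (hx hxx) hy (hne x hxx) hn, ← Real.norm_eq_abs]
  refine (ContinuousLinearMap.le_opNorm _ _).trans ?_
  rw [hn, mul_one, ← norm_gradient_eq]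
  refine norm_gradient_le_of_diffHarmonic hρ (fun x' hx' => ?_) (fun x' hx' => ?_) hM
    (hH.differentiableAt_sub (hx hxx) hy (hne x hxx))
  · exact (hH.differentiableAt_sub (hx hx') hy (hne x' hx')).continuousAt.continuousWithinAt
  · exact ((hH y hy).diffHarmonicAt x' (hx hx')).sub (diffHarmonicAt_inv_norm (hne x' hx'))

theorem half_norm_sub_le {x x' y : E3} {ρ : ℝ} (hρ : 2 * ρ ≤ ‖x - y‖)
    (hx' : x' ∈ Metric.ball x ρ) : ‖x - y‖ / 2 ≤ ‖x' - y‖ := by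
  rw [mem_ball_iff_norm'] at hx'
  have : ‖x - y‖ ≤ ‖x - x'‖ + ‖x' - y‖ := norm_sub_le_norm_sub_add_norm_sub x x' y
  linarith

theorem abs_greenSlope_le_inv (hH : IsRegularPart D H) (hD : IsOpen D) {r : ℝ} {p m x y n : E3}
    (hm : IsInnerNormal D r p m) (hn : ‖n‖ = 1) (hy : y ∈ D) {ρ : ℝ} (hρ : 0 < ρ)
    (hx : Metric.ball x ρ ⊆ D) (hyρ : 2 * ρ ≤ ‖x - y‖) :
    |greenSlope H n x y| ≤ 6 / ρ * ‖x - y‖⁻¹ := by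
  have hd : 0 < ‖x - y‖ := by linarith
  have := hH.abs_greenSlope_le hn hy hρ hx (by linarith) (M := 2 * ‖x - y‖⁻¹) (fun x' hx' => by
    have h1 := half_norm_sub_le hyρ hx'
    have h2 : 0 < ‖x' - y‖ := by linarith
    refine (hH.abs_sub_inv_norm_le_inv hD hm (hx hx') hy
      (sub_ne_zero.1 (norm_pos_iff.1 h2))).trans ?_
    calc ‖x' - y‖⁻¹ ≤ (‖x - y‖ / 2)⁻¹ := inv_anti₀ (by linarith) h1
      _ = 2 * ‖x - y‖⁻¹ := by field_simp)
  calc _ ≤ _ := this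
    _ = _ := by ring

/-- Here `p` is a boundary point near the pole, not the one nearest to `x`: the slope inherits the
linear decay of `G` as the pole approaches `p`. -/
theorem abs_greenSlope_le_of_frontier (hH : IsRegularPart D H) (hD : IsOpen D) {r : ℝ}
    {p m x y n : E3} (hm : IsInnerNormal D r p m) (hn : ‖n‖ = 1) (hy : y ∈ D) {ρ : ℝ} (hρ : 0 < ρ)
    (hx : Metric.ball x ρ ⊆ D) (hyρ : 2 * ρ ≤ ‖x - y‖) :
    |greenSlope H n x y| ≤ 6 / ρ ^ 3 * ‖y - p‖ := by
  have := hH.abs_greenSlope_le hn hy hρ hx (by linarith) (M := 2 * ‖y - p‖ / ρ ^ 2)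
    (fun x' hx' => by
    have h1 := half_norm_sub_le hyρ hx'
    have h2 : ρ ≤ ‖x' - y‖ := by linarith
    refine (hH.abs_sub_inv_norm_le hD hm (hx hx') hy
      (sub_ne_zero.1 (norm_pos_iff.1 (by linarith)))).trans ?_
    gcongr)
  calc _ ≤ _ := this
    _ = _ := by field_simp; ring

theorem tendsto_greenSlope_frontier (hH : IsRegularPart D H) (hD : IsOpen D) {r : ℝ}
    {z m x n : E3} (hm : IsInnerNormal D r z m) (hn : ‖n‖ = 1) (hx : x ∈ D) :
    Tendsto (greenSlope H n x) (𝓝[D] z) (𝓝 0) := by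
  obtain ⟨ρ, hρ, hxρ⟩ := Metric.isOpen_iff.1 hD x hx
  have hzx : ρ ≤ ‖z - x‖ := norm_sub_ge_of_ball_subset hxρ hm.notMem
  have hlim : Tendsto (fun y => 6 / (ρ / 4) ^ 3 * ‖y - z‖) (𝓝[D] z) (𝓝 0) := by
    have : ContinuousAt (fun y => 6 / (ρ / 4) ^ 3 * ‖y - z‖) z := by fun_prop
    simpa using this.tendsto.mono_left nhdsWithin_le_nhds
  refine squeeze_zero_norm' ?_ hlim
  filter_upwards [self_mem_nhdsWithin,
    nhdsWithin_le_nhds (Metric.ball_mem_nhds z (by positivity : 0 < ρ / 4))] with y hy hyz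
  refine hH.abs_greenSlope_le_of_frontier hD hm hn hy (by positivity)
    ((Metric.ball_subset_ball (by linarith)).trans hxρ) ?_
  rw [mem_ball_iff_norm] at hyz
  have : ‖z - x‖ ≤ ‖z - y‖ + ‖y - x‖ := norm_sub_le_norm_sub_add_norm_sub z y x
  rw [norm_sub_rev z y, norm_sub_rev y x] at this
  linarith

theorem tendsto_greenSlope_cobounded (hH : IsRegularPart D H) (hD : IsOpen D) {r : ℝ}
    {p m x n : E3} (hm : IsInnerNormal D r p m) (hn : ‖n‖ = 1) (hx : x ∈ D) :
    Tendsto (greenSlope H n x) (Bornology.cobounded E3 ⊓ 𝓟 D) (𝓝 0) := by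
  obtain ⟨ρ, hρ, hxρ⟩ := Metric.isOpen_iff.1 hD x hx
  have hlim : Tendsto (fun y => 6 / ρ * ‖y - x‖⁻¹) (Bornology.cobounded E3 ⊓ 𝓟 D) (𝓝 0) := by
    simpa using ((tendsto_inv_norm_sub_cobounded x).const_mul (6 / ρ)).mono_left inf_le_left
  refine squeeze_zero_norm' ?_ hlim
  have hfar : ∀ᶠ y in Bornology.cobounded E3, y ∉ Metric.ball x (2 * ρ) :=
    Bornology.isBounded_def.1 Metric.isBounded_ball
  filter_upwards [hfar.filter_mono inf_le_left,
    (mem_inf_of_right (mem_principal_self D) : D ∈ Bornology.cobounded E3 ⊓ 𝓟 D)] with y hy hyD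
  rw [norm_sub_rev y x]
  refine hH.abs_greenSlope_le_inv hD hm hn hyD hρ hxρ ?_
  rw [mem_ball_iff_norm', not_lt] at hy
  exact hy

theorem continuousAt_greenSlope (hH : IsRegularPart D H) (hD : IsOpen D) {x y n : E3}
    (hx : x ∈ D) (hy : y ∈ D) (hyx : y ≠ x) : ContinuousAt (greenSlope H n x) y := by
  refine ((hH.continuousOn_fderiv hD hx n).continuousAt (hD.mem_nhds hy)).sub ?_
  have : ‖y - x‖ ≠ 0 := norm_ne_zero_iff.2 (sub_ne_zero.2 hyx)
  exact ContinuousAt.div (by fun_prop) (by fun_prop) (pow_ne_zero 3 this)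

theorem diffHarmonicAt_greenSlope (hH : IsRegularPart D H) (hD : IsOpen D) {x y n : E3}
    (hn : ‖n‖ = 1) (hx : x ∈ D) (hy : y ∈ D) (hyx : y ≠ x) :
    DiffHarmonicAt (greenSlope H n x) y :=
  (hH.diffHarmonicAt_fderiv hD hx hy n hn).sub (diffHarmonicAt_dipole n hyx)

end IsRegularPart

/-! ### Comparison with the half-space. -/

/-- Used at boundary points of `D` of height `t` over the tangent plane, at distances `d` and `e`
from `x` and its mirror image. The two dipoles would cancel at `t = 0`; the interior ball makes `t`
quadratically small. -/
theorem dipole_sum_le {t b d e r : ℝ} (hd : 0 < d) (hde : d ≤ e) (hb : 0 < b) (ht : 0 ≤ t)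
    (hr : 0 < r) (htd : r * t ≤ 2 * d ^ 2) (hed : e ≤ 3 * d) :
    (t - b) / d ^ 3 + (t + b) / e ^ 3 ≤ 12 / r * e⁻¹ := by
  have he : 0 < e := hd.trans_le hde
  have h1 : (t + b) / e ^ 3 ≤ (t + b) / d ^ 3 := by gcongr
  have h2 : (t - b) / d ^ 3 + (t + b) / d ^ 3 = 2 * t / d ^ 3 := by ring
  have h3 : 2 * t / d ^ 3 ≤ 4 / (r * d) := by
    rw [div_le_div_iff₀ (by positivity) (by positivity)]
    nlinarith [mul_le_mul_of_nonneg_right htd hd.le]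
  have h4 : 4 / (r * d) ≤ 12 / r * e⁻¹ := by
    rw [← div_eq_mul_inv, div_div, div_le_div_iff₀ (by positivity) (by positivity)]
    nlinarith [mul_le_mul_of_nonneg_left hed hr.le]
  linarith

/-- The left side is the half-space slope for a pole at height `t`. The positive contribution `b
(1/d³ - 1/e³)` is itself of order `b² t`, because `e² - d² = 4 b t`; the condition `5 b ≤ e` lets
half of `t / d³` absorb it. -/
theorem dipole_sub_le {t b d e : ℝ} (hd : 0 < d) (hb : 0 < b) (ht : 0 ≤ t)
    (hed : e ^ 2 = d ^ 2 + 4 * b * t) (he : 5 * b ≤ e) :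
    (b - t) / d ^ 3 - (t + b) / e ^ 3 ≤ -(t / (2 * d ^ 3)) := by
  have he0 : 0 < e := by linarith
  have hde : d ≤ e := le_of_sq_le_sq (by rw [hed]; nlinarith [mul_nonneg hb.le ht]) he0.le
  have h1 : e ^ 3 - d ^ 3 ≤ 12 * b * t * e := by
    have : e ^ 3 - d ^ 3 = (e - d) * (e ^ 2 + e * d + d ^ 2) := by ring
    have h2 : (e - d) * (e + d) = 4 * b * t := by nlinarith
    have h3 : (e - d) * (e ^ 2 + e * d + d ^ 2) ≤ (e - d) * (3 * e * (e + d)) :=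
      mul_le_mul_of_nonneg_left (by nlinarith) (by linarith)
    have h4 : (e - d) * (3 * e * (e + d)) = 12 * b * t * e := by
      rw [show (e - d) * (3 * e * (e + d)) = 3 * e * ((e - d) * (e + d)) by ring, h2]; ring
    linarith
  have h2 : 1 / d ^ 3 - 1 / e ^ 3 ≤ 12 * b * t / (d ^ 3 * e ^ 2) := by
    rw [div_sub_div _ _ (by positivity) (by positivity), one_mul, mul_one,
      div_le_div_iff₀ (by positivity) (by positivity)]
    have := mul_le_mul_of_nonneg_right h1 (by positivity : 0 ≤ d ^ 3 * e ^ 2)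
    calc _ ≤ _ := this
      _ = _ := by ring
  have h3 : b * (12 * b * t / (d ^ 3 * e ^ 2)) ≤ t / (2 * d ^ 3) := by
    rw [← mul_div_assoc, div_le_div_iff₀ (by positivity) (by positivity)]
    have h5 : 24 * b ^ 2 ≤ e ^ 2 := by nlinarith
    have := mul_le_mul_of_nonneg_left h5 (by positivity : 0 ≤ t * d ^ 3)
    calc _ = t * d ^ 3 * (24 * b ^ 2) := by ring
      _ ≤ _ := this
      _ = _ := by ring
  have h4 : b * (1 / d ^ 3 - 1 / e ^ 3) ≤ b * (12 * b * t / (d ^ 3 * e ^ 2)) := by gcongr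
  have h5 : 0 ≤ t / e ^ 3 := by positivity
  have h6 : (b - t) / d ^ 3 - (t + b) / e ^ 3
      = b * (1 / d ^ 3 - 1 / e ^ 3) - 2 * (t / (2 * d ^ 3)) - t / e ^ 3 := by
    field_simp
    ring
  linarith

/-- At a point outside `D`, the interior ball bounds the height over a tangent plane. -/
theorem IsInnerNormal.inner_le {D : Set E3} {r : ℝ} {p n z : E3}
    (hn : IsInnerNormal D r p n) (hr : 0 < r) (hz : z ∉ D) :
    2 * r * inner ℝ n (z - p) ≤ ‖z - p‖ ^ 2 := by
  have h1 := IsRegularPart.norm_sub_ge_of_ball_subset hn.ball_subset hz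
  have h2 : r ^ 2 ≤ ‖z - (p + r • n)‖ ^ 2 := by gcongr
  rw [← sub_sub, norm_sub_sq_real, inner_smul_right, norm_smul, hn.norm_eq, mul_one,
    Real.norm_eq_abs, sq_abs, real_inner_comm] at h2
  linarith

namespace IsRegularPart

variable {D : Set E3} {H : E3 → E3 → ℝ}

/-- Comparison of the normal derivative of the Green function with that of a half-space. -/
theorem greenSlope_le (hH : IsRegularPart D H) (hD : IsOpen D) {r b : ℝ} {p n y : E3} (hr : 0 < r)
    (hfr : ∀ z ∈ frontier D, ∃ m, IsInnerNormal D r z m)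
    (hn : IsInnerNormal D r p n) (hb : 0 < b) (hx : Metric.ball (p + b • n) b ⊆ D) (hy : y ∈ D) :
    greenSlope H n (p + b • n) y ≤ (b - inner ℝ n (y - p)) / ‖y - (p + b • n)‖ ^ 3
      - (inner ℝ n (y - p) + b) / ‖y - (p - b • n)‖ ^ 3
      + 12 / r * ‖y - (p - b • n)‖⁻¹ := by
  set x := p + b • n with hxdef
  set x' := p - b • n with hx'def
  have hxD : x ∈ D := hx (Metric.mem_ball_self hb)
  have hix : ∀ z, inner ℝ n (z - x) = inner ℝ n (z - p) - b := fun z => by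
    rw [hxdef, ← sub_sub, inner_sub_right, inner_smul_right, real_inner_self_eq_norm_sq,
      hn.norm_eq]; ring
  have hix' : ∀ z, inner ℝ n (z - x') = inner ℝ n (z - p) + b := fun z => by
    rw [hx'def, ← sub_add, inner_add_right, inner_smul_right, real_inner_self_eq_norm_sq,
      hn.norm_eq]; ring
  have hne : ∀ z ∈ closure D, z ≠ x' := fun z hz h => by
    have h1 := hix' z
    have h2 := hn.inner_nonneg hz
    rw [h, sub_self, inner_zero_right, ← h] at h1
    linarith
  have hdip : ∀ z ∈ closure D, ContinuousAt (fun y => inner ℝ n (y - x') / ‖y - x'‖ ^ 3) z :=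
    fun z hz => ContinuousAt.div (by fun_prop) (by fun_prop)
      (pow_ne_zero 3 (norm_ne_zero_iff.2 (sub_ne_zero.2 (hne z hz))))
  -- The slope plus the dipoles at `x` and `x'`: the singularity at `x` cancels, and `x'` is outside
  -- the closure of `D`, so this function is harmonic on all of `D`. The monopole at `x'` dominates
  -- its boundary values.
  have key := diffHarmonic_le_zero hD
    (f := fun y => fderiv ℝ (H y) x n + inner ℝ n (y - x') / ‖y - x'‖ ^ 3
      - 12 / r * ‖y - x'‖⁻¹)
    (fun z hz => ((((hH.continuousOn_fderiv hD hxD n).continuousAt (hD.mem_nhds hz)).add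
      (hdip z (subset_closure hz))).sub ((continuousAt_inv_norm_sub
        (hne z (subset_closure hz))).const_mul _)).continuousWithinAt)
    (fun z hz => ((hH.diffHarmonicAt_fderiv hD hxD hz n hn.norm_eq).add
      (diffHarmonicAt_dipole n (hne z (subset_closure hz)))).sub
        ((diffHarmonicAt_inv_norm (hne z (subset_closure hz))).const_mul _))
    (fun z hz ε hε => by
      obtain ⟨m, hm⟩ := hfr z hz
      have hzc := frontier_subset_closure hz
      have hzx : z ≠ x := fun h => hm.notMem (h ▸ hxD)
      have hd : 0 < ‖z - x‖ := norm_pos_iff.2 (sub_ne_zero.2 hzx)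
      have hc1 : ContinuousAt (fun y => inner ℝ n (y - x) / ‖y - x‖ ^ 3) z :=
        ContinuousAt.div (by fun_prop) (by fun_prop) (pow_ne_zero 3 hd.ne')
      have hc2 : ContinuousAt (fun y => inner ℝ n (y - x) / ‖y - x‖ ^ 3
          + inner ℝ n (y - x') / ‖y - x'‖ ^ 3 - 12 / r * ‖y - x'‖⁻¹) z :=
        (hc1.add (hdip z hzc)).sub ((continuousAt_inv_norm_sub (hne z hzc)).const_mul _)
      have hlim := (hH.tendsto_greenSlope_frontier hD hm hn.norm_eq hxD).add
        (hc2.tendsto.mono_left nhdsWithin_le_nhds)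
      have hle : 0 + (inner ℝ n (z - x) / ‖z - x‖ ^ 3
          + inner ℝ n (z - x') / ‖z - x'‖ ^ 3 - 12 / r * ‖z - x'‖⁻¹) ≤ 0 := by
        have hbd : b ≤ ‖z - x‖ := norm_sub_ge_of_ball_subset hx hm.notMem
        have ht := hn.inner_nonneg hzc
        have hbn : ‖b • n‖ = b := by
          rw [norm_smul, hn.norm_eq, mul_one, Real.norm_eq_abs, abs_of_pos hb]
        have hzp : ‖z - p‖ ≤ ‖z - x‖ + b := by
          have : z - p = (z - x) + b • n := by rw [hxdef]; abel
          rw [this]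
          exact (norm_add_le _ _).trans (by rw [hbn])
        have hzx' : ‖z - x'‖ ≤ ‖z - x‖ + b + b := by
          have : z - x' = (z - x) + b • n + b • n := by rw [hxdef, hx'def]; abel
          rw [this]
          refine (norm_add_le _ _).trans ?_
          rw [hbn]
          have := norm_add_le (z - x) (b • n)
          rw [hbn] at this
          linarith
        have hge : ‖z - x‖ ≤ ‖z - x'‖ := by
          refine le_of_sq_le_sq ?_ (norm_nonneg _)
          have e1 : z - x = (z - p) - b • n := by rw [hxdef]; abel
          have e2 : z - x' = (z - p) + b • n := by rw [hx'def]; abel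
          rw [e1, e2, norm_sub_sq_real, norm_add_sq_real, inner_smul_right, real_inner_comm]
          have := mul_nonneg hb.le ht
          linarith
        -- Combined with `‖z - p‖ ≤ 2 ‖z - x‖`, this yields `r t ≤ 2 d²` for the height `t` of `z`.
        have hrt := hn.inner_le hr hm.notMem
        have hsq : ‖z - p‖ ^ 2 ≤ (2 * ‖z - x‖) ^ 2 := by
          gcongr; linarith
        rw [hix, hix']
        have := dipole_sum_le hd hge hb ht hr (by nlinarith) (by linarith)
        linarith
      filter_upwards [hlim.eventually (gt_mem_nhds (lt_of_le_of_lt hle hε))] with y hy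
      rw [greenSlope] at hy
      linarith)
    (fun ε hε => by
      obtain ⟨m, hm⟩ : ∃ m, IsInnerNormal D r p m := ⟨n, hn⟩
      have hdec : ∀ a : E3, Tendsto (fun y => inner ℝ n (y - a) / ‖y - a‖ ^ 3)
          (Bornology.cobounded E3) (𝓝 0) := fun a => by
        have h1 := (tendsto_inv_norm_sub_cobounded a).pow 2
        rw [zero_pow two_ne_zero] at h1
        refine squeeze_zero_norm (fun y => ?_) h1
        rcases eq_or_ne y a with h | h
        · simp [h]
        have h0 : 0 < ‖y - a‖ := norm_pos_iff.2 (sub_ne_zero.2 h)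
        have h2 := abs_real_inner_le_norm n (y - a)
        rw [hn.norm_eq, one_mul] at h2
        rw [Real.norm_eq_abs, abs_div, abs_of_pos (pow_pos h0 3), div_le_iff₀ (pow_pos h0 3)]
        calc _ ≤ _ := h2
          _ = _ := by field_simp
      have h1 := ((hH.tendsto_greenSlope_cobounded hD hm hn.norm_eq hxD).add
        ((hdec x).mono_left inf_le_left)).add (((hdec x').sub
          ((tendsto_inv_norm_sub_cobounded x').const_mul (12 / r))).mono_left inf_le_left)
      simp only [mul_zero, sub_zero, add_zero] at h1
      filter_upwards [h1.eventually (gt_mem_nhds hε)] with y hy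
      rw [greenSlope] at hy
      linarith) y hy
  rw [greenSlope, hix]
  rw [hix'] at key
  have : (b - inner ℝ n (y - p)) / ‖y - x‖ ^ 3 = -((inner ℝ n (y - p) - b) / ‖y - x‖ ^ 3) := by ring
  linarith

end IsRegularPart

/-- The lowest point of the ball is in the closure of `D`, hence not below the tangent plane. -/
theorem IsInnerNormal.le_inner_of_ball_subset {D : Set E3} {r σ : ℝ} {p n y : E3}
    (hn : IsInnerNormal D r p n) (hσ : 0 < σ) (hy : Metric.ball y σ ⊆ D) :
    σ ≤ inner ℝ n (y - p) := by
  have hmem : y - σ • n ∈ closure D := by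
    refine closure_mono hy ?_
    rw [closure_ball y hσ.ne', mem_closedBall_iff_norm, sub_sub_cancel_left, norm_neg, norm_smul,
      hn.norm_eq, mul_one, Real.norm_eq_abs, abs_of_pos hσ]
  have := hn.inner_nonneg hmem
  rw [sub_right_comm, inner_sub_right, inner_smul_right, real_inner_self_eq_norm_sq,
    hn.norm_eq] at this
  linarith

/-! ### The sign of the slope at intermediate distances. -/

namespace IsRegularPart

variable {D : Set E3} {H : E3 → E3 → ℝ}

/-- At distance `R` from the boundary point `p`, for `R` large with respect to the height of `x`
and small with respect to the radius of the interior balls. -/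
theorem greenSlope_le_of_norm_sub (hH : IsRegularPart D H) (hD : IsOpen D) {r b R τ : ℝ}
    {p n y : E3} (hfr : ∀ z ∈ frontier D, ∃ m, IsInnerNormal D r z m)
    (hn : IsInnerNormal D r p n) (hb : 0 < b) (hx : Metric.ball (p + b • n) b ⊆ D) (hy : y ∈ D)
    (hbR : 12 * b ≤ R) (hRr : 200000 * R ≤ r) (h1 : 11 / 16 * R ≤ ‖y - p‖)
    (h2 : ‖y - p‖ ≤ 21 / 16 * R) (hτ : τ * R ≤ inner ℝ n (y - p)) :
    greenSlope H n (p + b • n) y ≤ (3 / 25000 - τ / 16) / R ^ 2 := by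
  have hR : 0 < R := by linarith
  have hr : 0 < r := by linarith
  have key := hH.greenSlope_le hD hr hfr hn hb hx hy
  have ht := (hn.inner_pos y hy).le
  set t := inner ℝ n (y - p) with htdef
  have hbn : ‖b • n‖ = b := by
    rw [norm_smul, hn.norm_eq, mul_one, Real.norm_eq_abs, abs_of_pos hb]
  have e1 : y - (p + b • n) = (y - p) - b • n := by abel
  have e2 : y - (p - b • n) = (y - p) + b • n := by abel
  have hd2 : ‖y - (p + b • n)‖ ≤ 2 * R := by
    rw [e1]
    have := norm_sub_le (y - p) (b • n)
    linarith
  have hd0 : 0 < ‖y - (p + b • n)‖ := by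
    rw [e1]
    have := norm_sub_norm_le (y - p) (b • n)
    linarith
  have he : 1 / 2 * R ≤ ‖y - (p - b • n)‖ := by
    rw [e2]
    have := norm_sub_le (y - p + b • n) (b • n)
    rw [add_sub_cancel_right] at this
    linarith
  have hed : ‖y - (p - b • n)‖ ^ 2 = ‖y - (p + b • n)‖ ^ 2 + 4 * b * t := by
    rw [e1, e2, norm_sub_sq_real, norm_add_sq_real, inner_smul_right, real_inner_comm]
    ring
  set d := ‖y - (p + b • n)‖
  set e := ‖y - (p - b • n)‖
  have k1 := dipole_sub_le hd0 hb ht hed (by linarith)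
  have k2 : t / (2 * (2 * R) ^ 3) ≤ t / (2 * d ^ 3) := by gcongr
  have k3 : τ / 16 / R ^ 2 ≤ t / (2 * (2 * R) ^ 3) := by
    rw [div_div, div_le_div_iff₀ (by positivity) (by positivity)]
    have := mul_le_mul_of_nonneg_right hτ (by positivity : 0 ≤ 16 * R ^ 2)
    calc _ = τ * R * (16 * R ^ 2) := by ring
      _ ≤ _ := this
      _ = _ := by ring
  -- The curvature error: `12 / 200000` times `2` is `3 / 25000`.
  have k4 : 12 / r * e⁻¹ ≤ 3 / 25000 / R ^ 2 := by
    have a1 : 12 / r ≤ 12 / (200000 * R) := by gcongr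
    have a2 : e⁻¹ ≤ (1 / 2 * R)⁻¹ := inv_anti₀ (by positivity) he
    calc 12 / r * e⁻¹ ≤ 12 / (200000 * R) * (1 / 2 * R)⁻¹ := by gcongr
      _ = _ := by field_simp; norm_num
  rw [sub_div]
  linarith

/-- Away from `x`, relative to its height, and close to the boundary, relative to the radius of
the interior balls, the Green function increases towards the boundary. -/
theorem greenSlope_nonpos (hH : IsRegularPart D H) (hD : IsOpen D) {r b s : ℝ}
    {p n q m y₀ : E3} (hfr : ∀ z ∈ frontier D, ∃ m, IsInnerNormal D r z m)
    (hn : IsInnerNormal D r p n) (hb : 0 < b) (hx : Metric.ball (p + b • n) b ⊆ D)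
    (hm : IsInnerNormal D r q m) (hs : 0 < s) (hball : Metric.ball y₀ s ⊆ D)
    (hy₀ : y₀ = q + s • m) (hbR : 12 * b ≤ ‖y₀ - p‖) (hRr : 200000 * ‖y₀ - p‖ ≤ r) :
    greenSlope H n (p + b • n) y₀ ≤ 0 := by
  set R := ‖y₀ - p‖ with hRdef
  have hR : 0 < R := by linarith
  have hr : 0 < r := by linarith
  have hy₀D : y₀ ∈ D := hball (Metric.mem_ball_self hs)
  -- A pole at distance at least `R / 32` from the boundary has at least that height over the plane
  -- at `p`, and the half-space term already wins. The rest treats poles close to the boundary.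
  rcases le_or_gt (R / 32) s with hsR | hsR
  · have h1 := hn.le_inner_of_ball_subset hs hball
    refine (hH.greenSlope_le_of_norm_sub hD hfr hn hb hx hy₀D hbR hRr (τ := 1 / 32)
      (by linarith) (by linarith) (by linarith)).trans ?_
    exact div_nonpos_of_nonpos_of_nonneg (by norm_num) (by positivity)
  have hsm : ‖s • m‖ = s := by
    rw [norm_smul, hm.norm_eq, mul_one, Real.norm_eq_abs, abs_of_pos hs]
  have hqp : ∀ y, ‖y - q‖ ≤ R / 4 → 11 / 16 * R ≤ ‖y - p‖ ∧ ‖y - p‖ ≤ 21 / 16 * R := by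
    intro y hy
    have e1 : y - p = (y₀ - p) + ((y - q) - s • m) := by rw [hy₀]; abel
    have h1 : ‖(y - q) - s • m‖ ≤ R / 4 + s := (norm_sub_le _ _).trans (by linarith)
    have h2 := norm_add_le (y₀ - p) ((y - q) - s • m)
    have h3 := norm_sub_le ((y₀ - p) + ((y - q) - s • m)) ((y - q) - s • m)
    rw [add_sub_cancel_right] at h3
    rw [← e1] at h2 h3
    constructor <;> linarith
  set x := p + b • n with hxdef
  have hxD : x ∈ D := hx (Metric.mem_ball_self hb)
  have hxne : ∀ y, ‖y - q‖ ≤ R / 4 → y ≠ x := fun y hy h => by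
    have h1 := (hqp y hy).1
    rw [h, hxdef, add_sub_cancel_left, norm_smul, hn.norm_eq, mul_one, Real.norm_eq_abs,
      abs_of_pos hb] at h1
    linarith
  -- Barrier around `q`: nonnegative on the boundary of `D`, of order `R²` on the lateral sphere
  -- where the slope may be slightly positive, negative on the normal through `q`. Its negative
  -- values on the top face are affordable because the slope is definitely negative there.
  set Q : E3 → ℝ := fun y =>
    ‖y - q‖ ^ 2 - 3 * inner ℝ m (y - q) ^ 2 + (-R) * inner ℝ m (y - q) with hQ
  set c : ℝ := 1 / (128 * R ^ 4) with hc
  have hc0 : 0 < c := by positivity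
  have hcQ : ∀ κ y, κ * R ^ 2 ≤ Q y → κ / 128 / R ^ 2 ≤ c * Q y := fun κ y h => by
    calc κ / 128 / R ^ 2 = c * (κ * R ^ 2) := by rw [hc]; field_simp
      _ ≤ c * Q y := by gcongr
  have hQc : Continuous Q := by fun_prop
  set U : Set E3 := D ∩ {y | ‖y - q‖ < R / 4 ∧ inner ℝ m (y - q) < R / 32} with hU
  have hUo : IsOpen U := by
    have h1 : IsOpen {y : E3 | ‖y - q‖ < R / 4} := isOpen_lt (by fun_prop) continuous_const
    have h2 : IsOpen {y : E3 | inner ℝ m (y - q) < R / 32} :=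
      isOpen_lt (by fun_prop) continuous_const
    exact hD.inter (h1.inter h2)
  have hUcl : ∀ z ∈ closure U, z ∈ closure D ∧ ‖z - q‖ ≤ R / 4 ∧ inner ℝ m (z - q) ≤ R / 32 := by
    intro z hz
    refine ⟨closure_mono Set.inter_subset_left hz, ?_⟩
    have : closure U ⊆ {y | ‖y - q‖ ≤ R / 4} ∩ {y | inner ℝ m (y - q) ≤ R / 32} :=
      closure_minimal (fun y hy => ⟨hy.2.1.le, hy.2.2.le⟩)
        ((isClosed_le (by fun_prop) continuous_const).inter
          (isClosed_le (by fun_prop) continuous_const))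
    exact this hz
  have key := diffHarmonic_le_zero hUo (f := fun y => greenSlope H n x y - c * Q y)
    (fun z hz => ((hH.continuousAt_greenSlope hD hxD hz.1 (hxne z hz.2.1.le)).sub
      (by fun_prop)).continuousWithinAt)
    (fun z hz => (hH.diffHarmonicAt_greenSlope hD hn.norm_eq hxD hz.1 (hxne z hz.2.1.le)).sub
      ((diffHarmonicAt_barrier q z hm.norm_eq (-R)).const_mul c))
    (fun z hz ε hε => by
      rw [frontier, hUo.interior_eq] at hz
      obtain ⟨hzc, hzq, hzt⟩ := hUcl z hz.1
      have ht0 := hm.inner_nonneg hzc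
      have hQcont : ContinuousAt (fun y => c * Q y) z := by fun_prop
      by_cases hzD : z ∈ D
      · have hcont := (hH.continuousAt_greenSlope (n := n) hD hxD hzD (hxne z hzq)).sub hQcont
        refine (hcont.eventually (gt_mem_nhds (lt_of_le_of_lt ?_ hε))).filter_mono
          nhdsWithin_le_nhds
        have hR2 : 0 < R ^ 2 := by positivity
        by_cases hlt : ‖z - q‖ < R / 4
        · have ht1 : inner ℝ m (z - q) = R / 32 := by
            refine le_antisymm hzt ?_
            by_contra! h
            exact hz.2 ⟨hzD, hlt, h⟩
          -- On the top face, `z` has height `R / 32` over the plane at `q` and lies well inside the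
          -- interior ball there, whose radius is huge compared with `R`. This gives height at least
          -- `R / 64` over the plane at `p`.
          have hzball : Metric.ball z (R / 64) ⊆ D := by
            refine (Metric.ball_subset_ball' ?_).trans hm.ball_subset
            rw [dist_eq_norm, ← le_sub_iff_add_le']
            refine le_of_sq_le_sq ?_ (by linarith)
            rw [← sub_sub, norm_sub_sq_real, inner_smul_right, norm_smul, hm.norm_eq, mul_one,
              Real.norm_eq_abs, sq_abs, real_inner_comm, ht1]
            have : ‖z - q‖ ^ 2 ≤ (R / 4) ^ 2 := by gcongr
            nlinarith
          have h1 := hn.le_inner_of_ball_subset (by positivity) hzball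
          have h2 := hH.greenSlope_le_of_norm_sub hD hfr hn hb hx hzD hbR hRr (τ := 1 / 64)
            (hqp z hzq).1 (hqp z hzq).2 (by linarith)
          have h3 := hcQ (-(35 / 1024)) z (by
            simp only [hQ, ht1]
            nlinarith [sq_nonneg ‖z - q‖])
          have h4 : (3 / 25000 - 1 / 64 / 16) / R ^ 2 ≤ -(35 / 1024) / 128 / R ^ 2 := by
            gcongr; norm_num
          change greenSlope H n x z - c * Q z ≤ 0
          linarith
        · have hzq' : ‖z - q‖ = R / 4 := le_antisymm hzq (not_lt.1 hlt)
          have h2 := hH.greenSlope_le_of_norm_sub hD hfr hn hb hx hzD hbR hRr (τ := 0)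
            (hqp z hzq).1 (hqp z hzq).2 (by rw [zero_mul]; exact (hn.inner_pos z hzD).le)
          have h3 := hcQ (29 / 1024) z (by
            simp only [hQ, hzq']
            nlinarith)
          have h4 : (3 / 25000 - 0 / 16) / R ^ 2 ≤ 29 / 1024 / 128 / R ^ 2 := by
            gcongr; norm_num
          change greenSlope H n x z - c * Q z ≤ 0
          linarith
      · have hzf : z ∈ frontier D := by
          rw [frontier, hD.interior_eq]; exact ⟨hzc, hzD⟩
        obtain ⟨m', hm'⟩ := hfr z hzf
        have hlim := (hH.tendsto_greenSlope_frontier hD hm' hn.norm_eq hxD).sub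
          (hQcont.tendsto.mono_left nhdsWithin_le_nhds)
        refine (hlim.eventually (gt_mem_nhds (lt_of_le_of_lt ?_ hε))).filter_mono
          (nhdsWithin_mono z Set.inter_subset_left)
        have h1 := hm.inner_le hr hzD
        -- On the boundary of `D`, `‖z - q‖²` is at least `2 r` times the height, which outweighs
        -- the other two terms since the height is at most `R / 32` and `r` is much larger than `R`.
        have h2 : 0 ≤ Q z := by
          simp only [hQ]
          nlinarith
        have := mul_nonneg hc0.le h2
        linarith)
    (fun ε hε => by
      have hbd : Bornology.IsBounded U := by
        refine (Metric.isBounded_ball (x := q) (r := R / 4)).subset fun y hy => ?_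
        exact mem_ball_iff_norm.2 hy.2.1
      have : Uᶜ ∈ Bornology.cobounded E3 := Bornology.isBounded_def.1 hbd
      rw [eventually_inf_principal]
      filter_upwards [this] with y hy hy'
      exact absurd hy' hy)
  have e1 : y₀ - q = s • m := by rw [hy₀, add_sub_cancel_left]
  have e2 : inner ℝ m (y₀ - q) = s := by
    rw [e1, inner_smul_right, real_inner_self_eq_norm_sq, hm.norm_eq]; ring
  have hk := key y₀ ⟨hy₀D, by rw [e1, hsm]; linarith, by rw [e2]; exact hsR⟩
  have hQ0 : Q y₀ ≤ 0 := by
    simp only [hQ, e2]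
    rw [e1, hsm]
    nlinarith
  have := mul_nonpos_of_nonneg_of_nonpos hc0.le hQ0
  linarith

end IsRegularPart

/-! ### The bound from the Hessian. -/

/-- The slope on the whole interval is at least `g₁ b - M b`. If this were positive, `g` would
increase from `0` to a positive value at `b`. -/
theorem deriv_le_of_tendsto_zero {g g₁ g₂ : ℝ → ℝ} {b M : ℝ} (hb : 0 < b)
    (h1 : ∀ t ∈ Set.Ioc 0 b, HasDerivAt g (g₁ t) t)
    (h2 : ∀ t ∈ Set.Ioc 0 b, HasDerivAt g₁ (g₂ t) t) (hM : ∀ t ∈ Set.Ioc 0 b, |g₂ t| ≤ M)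
    (h0 : Tendsto g (𝓝[>] 0) (𝓝 0)) (hgb : g b ≤ 0) : g₁ b ≤ M * b := by
  have hbm : b ∈ Set.Ioc 0 b := ⟨hb, le_rfl⟩
  have hM0 : 0 ≤ M := (abs_nonneg _).trans (hM b hbm)
  have s1 : ∀ t ∈ Set.Ioc 0 b, g₁ b - M * b ≤ g₁ t := fun t ht => by
    have := (convex_Ioc 0 b).norm_image_sub_le_of_norm_hasDerivWithin_le
      (fun x hx => (h2 x hx).hasDerivWithinAt) hM ht hbm
    rw [Real.norm_eq_abs, Real.norm_eq_abs, abs_of_nonneg (by linarith [ht.2] : 0 ≤ b - t)] at this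
    have h3 := (le_abs_self _).trans this
    nlinarith [mul_nonneg hM0 ht.1.le]
  have hd : ∀ t ∈ Set.Ioc 0 b, HasDerivAt (fun t => g t - (g₁ b - M * b) * t)
      (g₁ t - (g₁ b - M * b)) t := fun t ht => by
    simpa using (h1 t ht).fun_sub ((hasDerivAt_id t).const_mul (g₁ b - M * b))
  have hmono : MonotoneOn (fun t => g t - (g₁ b - M * b) * t) (Set.Ioc 0 b) :=
    monotoneOn_of_deriv_nonneg (convex_Ioc 0 b)
      (fun t ht => (hd t ht).continuousAt.continuousWithinAt)
      (fun t ht => (hd t (interior_subset ht)).differentiableAt.differentiableWithinAt)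
      (fun t ht => by
        rw [(hd t (interior_subset ht)).deriv]
        linarith [s1 t (interior_subset ht)])
  have hlin : Tendsto (fun t : ℝ => (g₁ b - M * b) * t) (𝓝[>] 0) (𝓝 0) := by
    have : ContinuousAt (fun t : ℝ => (g₁ b - M * b) * t) 0 := by fun_prop
    simpa using this.tendsto.mono_left nhdsWithin_le_nhds
  have hle := le_of_tendsto (h0.sub hlin) (b := g b - (g₁ b - M * b) * b) (by
    filter_upwards [Ioc_mem_nhdsGT hb] with t ht
    exact hmono ht hbm ht.2)
  rw [sub_zero] at hle
  nlinarith

theorem inner_gradient_eq_fderiv (f : E3 → ℝ) (x n : E3) :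
    inner ℝ n (gradient f x) = fderiv ℝ f x n := by
  rw [real_inner_comm, gradient, InnerProductSpace.toDual_symm_apply]

theorem contDiffAt_inv_norm_sub {x y : E3} (hxy : x ≠ y) :
    ContDiffAt ℝ 2 (fun x => ‖x - y‖⁻¹) x := by
  have h0 : x - y ≠ 0 := sub_ne_zero.2 hxy
  exact ((contDiffAt_id.sub contDiffAt_const).norm ℝ h0).inv (norm_ne_zero_iff.2 h0)

/-- The Hessian bound controls the increase of the Green function towards the boundary. -/
theorem inner_gradient_le_of_hessian_bound {D : Set E3} {G H : E3 → E3 → ℝ} (hD : IsOpen D)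
    (hG : IsDirichletGreenFunction D G) (hH : IsRegularPart D H)
    (hH2 : ∀ y ∈ D, ∀ x ∈ D, ContDiffAt ℝ 2 (H y) x)
    (hGH : ∀ y ∈ D, ∀ x ∈ D, x ≠ y → G x y = (4 * Real.pi)⁻¹ * (H y x - ‖x - y‖⁻¹))
    {A : ℝ} (hA : ∀ x ∈ D, ∀ y ∈ D, x ≠ y →
      ‖x - y‖ ^ 3 * (‖iteratedFDeriv ℝ 2 (fun z => G z y) x‖ +
        ‖iteratedFDeriv ℝ 2 (fun z => G x z) y‖) ≤ A)
    {b : ℝ} {p n y : E3} (hp : p ∈ frontier D) (hn : ‖n‖ = 1) (hb : 0 < b)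
    (hx : Metric.ball (p + b • n) b ⊆ D) (hy : y ∈ D) (hby : 2 * b ≤ ‖p + b • n - y‖) :
    inner ℝ n (gradient (fun z => G z y) (p + b • n)) ≤
      8 * A * b / ‖p + b • n - y‖ ^ 3 := by
  set x := p + b • n with hxdef
  set f : E3 → ℝ := fun z => G z y with hf
  have hd : 0 < ‖x - y‖ := by linarith
  have hxD : x ∈ D := hx (Metric.mem_ball_self hb)
  have hxy : x ≠ y := sub_ne_zero.1 (norm_pos_iff.1 hd)
  have hA0 : 0 ≤ A := le_trans (by positivity) (hA x hxD y hy hxy)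
  have hdist : ∀ t, ‖x - (p + t • n)‖ = |b - t| := fun t => by
    rw [hxdef, add_sub_add_left_eq_sub, ← sub_smul, norm_smul, hn, mul_one, Real.norm_eq_abs]
  have hD' : ∀ t ∈ Set.Ioc 0 b, p + t • n ∈ D := fun t ht => hx (by
    rw [mem_ball_iff_norm', hdist, abs_of_nonneg (by linarith [ht.2])]
    linarith [ht.1])
  have hfar : ∀ t ∈ Set.Ioc 0 b, ‖x - y‖ / 2 ≤ ‖p + t • n - y‖ := fun t ht => by
    have h1 : ‖x - y‖ ≤ ‖x - (p + t • n)‖ + ‖p + t • n - y‖ :=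
      norm_sub_le_norm_sub_add_norm_sub _ _ _
    rw [hdist, abs_of_nonneg (by linarith [ht.2])] at h1
    linarith [ht.1]
  have hne : ∀ t ∈ Set.Ioc 0 b, p + t • n ≠ y := fun t ht =>
    sub_ne_zero.1 (norm_pos_iff.1 (by linarith [hfar t ht]))
  have hC2 : ∀ t ∈ Set.Ioc 0 b, ContDiffAt ℝ 2 f (p + t • n) := fun t ht => by
    have h1 : ContDiffAt ℝ 2 (fun z => (4 * Real.pi)⁻¹ * (H y z - ‖z - y‖⁻¹)) (p + t • n) :=
      contDiffAt_const.mul ((hH2 y hy _ (hD' t ht)).sub (contDiffAt_inv_norm_sub (hne t ht)))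
    refine h1.congr_of_eventuallyEq ?_
    filter_upwards [hD.mem_nhds (hD' t ht), isOpen_ne.mem_nhds (hne t ht)] with z hz hzy
    exact hGH y hy z hz hzy
  have hline : ∀ t, HasDerivAt (fun t : ℝ => p + t • n) n t := fun t => by
    simpa using ((hasDerivAt_id t).smul_const n).const_add p
  have key := deriv_le_of_tendsto_zero hb (g := fun t => f (p + t • n))
    (g₁ := fun t => fderiv ℝ f (p + t • n) n)
    (g₂ := fun t => fderiv ℝ (fderiv ℝ f) (p + t • n) n n) (M := 8 * A / ‖x - y‖ ^ 3)
    (fun t ht => by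
      have h1 : DifferentiableAt ℝ f (p + t • n) := (hC2 t ht).differentiableAt (by norm_num)
      exact h1.hasFDerivAt.comp_hasDerivAt t (hline t))
    (fun t ht => by
      have h1 : DifferentiableAt ℝ (fderiv ℝ f) (p + t • n) :=
        ((hC2 t ht).fderiv_right (m := 1) (by norm_num)).differentiableAt (by norm_num)
      have h2 := h1.hasFDerivAt.comp_hasDerivAt t (hline t)
      simpa using h2.clm_apply (hasDerivAt_const t n))
    (fun t ht => by
      have h1 : |fderiv ℝ (fderiv ℝ f) (p + t • n) n n| ≤ ‖iteratedFDeriv ℝ 2 f (p + t • n)‖ := by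
        rw [← norm_fderiv_fderiv, ← Real.norm_eq_abs]
        simpa [hn] using ContinuousLinearMap.le_opNorm₂ (fderiv ℝ (fderiv ℝ f) (p + t • n)) n n
      have h2 := hA _ (hD' t ht) y hy (hne t ht)
      have h3 : ‖p + t • n - y‖ ^ 3 * ‖iteratedFDeriv ℝ 2 f (p + t • n)‖ ≤ A :=
        le_trans (mul_le_mul_of_nonneg_left (le_add_of_nonneg_right (norm_nonneg _))
          (by positivity)) h2
      have h4 : (‖x - y‖ / 2) ^ 3 ≤ ‖p + t • n - y‖ ^ 3 := by
        gcongr; exact hfar t ht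
      refine h1.trans ?_
      rw [le_div_iff₀ (by positivity)]
      have h5 := mul_le_mul_of_nonneg_right h4 (norm_nonneg (iteratedFDeriv ℝ 2 f (p + t • n)))
      nlinarith)
    (by
      have h1 : Tendsto (fun t : ℝ => p + t • n) (𝓝[>] 0) (𝓝[D] p) := by
        refine tendsto_nhdsWithin_iff.2 ⟨?_, ?_⟩
        · simpa using (hline 0).continuousAt.tendsto.mono_left nhdsWithin_le_nhds
        · filter_upwards [Ioc_mem_nhdsGT hb] with t ht using hD' t ht
      exact (hG.boundary y hy p hp).comp h1)
    (by
      have h1 := hH.le_inv_norm hD hxD hy hxy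
      change G x y ≤ 0
      rw [hGH y hy x hxD hxy]
      exact mul_nonpos_of_nonneg_of_nonpos (by positivity) (by linarith))
  rw [inner_gradient_eq_fderiv]
  calc _ ≤ _ := key
    _ = _ := by ring

theorem inner_gradient_eq_greenSlope {D : Set E3} {G H : E3 → E3 → ℝ} (hD : IsOpen D)
    (hH : IsRegularPart D H)
    (hGH : ∀ y ∈ D, ∀ x ∈ D, x ≠ y → G x y = (4 * Real.pi)⁻¹ * (H y x - ‖x - y‖⁻¹))
    {n x y : E3} (hn : ‖n‖ = 1) (hx : x ∈ D) (hy : y ∈ D) (hxy : x ≠ y) :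
    inner ℝ n (gradient (fun z => G z y) x) = (4 * Real.pi)⁻¹ * greenSlope H n x y := by
  have heq : (fun z => G z y) =ᶠ[𝓝 x] fun z => (4 * Real.pi)⁻¹ * (H y z - ‖z - y‖⁻¹) := by
    filter_upwards [hD.mem_nhds hx, isOpen_ne.mem_nhds hxy] with z hz hzy
    exact hGH y hy z hz hzy
  rw [inner_gradient_eq_fderiv, heq.fderiv_eq, fderiv_const_mul (hH.differentiableAt_sub hx hy hxy),
    smul_apply, hH.fderiv_sub_eq hx hy hxy hn, smul_eq_mul]

/-! ### Pointwise bounds in the three regimes. -/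

/-- Pointwise bounds for the positive part of the normal derivative of the Green function. -/
theorem exists_normalDerivPos_bounds {D : Set E3} (hD : IsOpen D) (hDc : Convex ℝ D)
    (hDbdry : (frontier D).Nonempty) {α : ℝ} (hDreg : IsC2HolderDomain α D) {G : E3 → E3 → ℝ}
    (hG : IsDirichletGreenFunction D G) (hGbound : GreenHessianBound D G) :
    ∃ C > 0, ∃ ε > 0, ∀ x ∈ D, DifferentiableAt ℝ (extendedDist D) x →
      0 < extendedDist D x ∧ ContinuousOn (normalDerivPos D G x) (D \ {x}) ∧
      ∀ y ∈ D, x ≠ y →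
        (‖x - y‖ ≤ 13 * extendedDist D x → normalDerivPos D G x y ≤ C * (‖x - y‖ ^ 2)⁻¹) ∧
        (13 * extendedDist D x ≤ ‖x - y‖ → ‖x - y‖ ≤ ε → normalDerivPos D G x y = 0) ∧
        normalDerivPos D G x y ≤ C * (extendedDist D x * (‖x - y‖ ^ 3)⁻¹) := by
  obtain ⟨H, hH, hH2, hGH⟩ := hG.exists_isRegularPart hD
  obtain ⟨A, hA⟩ := hGbound
  obtain ⟨r, hr, hfr, hnear⟩ := exists_isInnerNormal hD hDc hDreg
  have hne : (Dᶜ).Nonempty := by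
    obtain ⟨p, hp⟩ := hDbdry
    exact ⟨p, notMem_of_mem_frontier hD hp⟩
  have hnearest : ∀ x ∈ D, ∃ p ∈ frontier D, ∃ n, ∃ b > 0, IsInnerNormal D r p n ∧
      Metric.ball x b ⊆ D ∧ x = p + b • n ∧ extendedDist D x = b ∧
      (DifferentiableAt ℝ (extendedDist D) x → gradient (extendedDist D) x = n) := by
    intro x hx
    obtain ⟨p, hp, hpos, hdist, hball⟩ := exists_nearest_frontier hD hne hx
    have hpD := notMem_of_mem_frontier hD hp
    refine ⟨p, hp, _, ‖x - p‖, hpos, hnear x hx p hpD hpos hball hp, hball, ?_, ?_,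
      fun hd => gradient_extendedDist hD hx hpD hpos hdist hd⟩
    · rw [smul_inv_smul₀ hpos.ne']; abel
    · simp [extendedDist, hx, hdist]
  -- `2028 = 13 * 156` turns the near bound `156 / |x - y|²` into one by `b / |x - y|³` when `|x -
  -- y| ≤ 13 b`. The radius `r / 400000` leaves a factor two for passing from `|x - y|` to `|y -
  -- p|`; likewise `13 b` leaves `12 b`.
  refine ⟨2028 + 8 * |A|, by positivity, r / 400000, by positivity, fun x hx hdiff => ?_⟩
  obtain ⟨p, hp, n, b, hb, hn, hball, hxp, hbx, hgrad⟩ := hnearest x hx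
  have hval : ∀ y, normalDerivPos D G x y = max (inner ℝ n (gradient (fun z => G z y) x)) 0 :=
    fun y => by rw [normalDerivPos, hgrad hdiff]
  have hpi : (4 * Real.pi)⁻¹ ≤ 1 := inv_le_one_of_one_le₀ (by linarith [Real.pi_gt_three])
  have hpi0 : 0 < (4 * Real.pi)⁻¹ := by positivity
  rw [hbx]
  refine ⟨hb, ?_, fun y hy hxy => ?_⟩
  · refine ContinuousOn.congr
      (f := fun y => max ((4 * Real.pi)⁻¹ * greenSlope H n x y) 0) (fun y hy => ?_)
      (fun y hy => ?_)
    · have h1 : ContinuousAt (fun y => (4 * Real.pi)⁻¹ * greenSlope H n x y) y :=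
        continuousAt_const.mul (hH.continuousAt_greenSlope hD hx hy.1 hy.2)
      have h2 : ContinuousAt (fun y => max ((4 * Real.pi)⁻¹ * greenSlope H n x y) 0) y :=
        Tendsto.max h1 tendsto_const_nhds
      exact h2.continuousWithinAt
    · rw [hval, inner_gradient_eq_greenSlope hD hH hGH hn.norm_eq hx hy.1 (Ne.symm hy.2)]
  · have hd : 0 < ‖x - y‖ := norm_pos_iff.2 (sub_ne_zero.2 hxy)
    have hslope := inner_gradient_eq_greenSlope hD hH hGH hn.norm_eq hx hy hxy
    have hnearbd : ‖x - y‖ ≤ 13 * b → normalDerivPos D G x y ≤ 156 * (‖x - y‖ ^ 2)⁻¹ := by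
      intro hle
      have h1 := hH.abs_greenSlope_le_inv hD hn hn.norm_eq hy (ρ := ‖x - y‖ / 26) (by positivity)
        ((Metric.ball_subset_ball (by linarith)).trans hball) (by linarith)
      have h2 : 6 / (‖x - y‖ / 26) * ‖x - y‖⁻¹ = 156 * (‖x - y‖ ^ 2)⁻¹ := by
        field_simp; norm_num
      rw [hval, hslope]
      refine max_le ?_ (by positivity)
      calc (4 * Real.pi)⁻¹ * greenSlope H n x y ≤ (4 * Real.pi)⁻¹ * |greenSlope H n x y| := by
            gcongr; exact le_abs_self _
        _ ≤ 1 * |greenSlope H n x y| := by gcongr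
        _ ≤ _ := by rw [one_mul, ← h2]; exact h1
    refine ⟨fun hle => (hnearbd hle).trans ?_, fun h1 h2 => ?_, ?_⟩
    · gcongr
      linarith [abs_nonneg A]
    · obtain ⟨q, hq, m, s, hs, hm, hballs, hyq, -, -⟩ := hnearest y hy
      have hbn : ‖b • n‖ = b := by
        rw [norm_smul, hn.norm_eq, mul_one, Real.norm_eq_abs, abs_of_pos hb]
      have e1 : y - p = b • n - (x - y) := by rw [hxp]; abel
      have h3 : ‖y - p‖ ≤ b + ‖x - y‖ := by
        rw [e1]; exact (norm_sub_le _ _).trans (by rw [hbn])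
      have h4 : ‖x - y‖ ≤ b + ‖y - p‖ := by
        have : x - y = b • n - (y - p) := by rw [e1]; abel
        rw [this]; exact (norm_sub_le _ _).trans (by rw [hbn])
      have h5 := hH.greenSlope_nonpos hD hfr hn hb (by rw [← hxp]; exact hball) hm hs hballs hyq
        (by linarith) (by linarith)
      rw [← hxp] at h5
      rw [hval, hslope]
      exact max_eq_right (mul_nonpos_of_nonneg_of_nonpos hpi0.le h5)
    · rcases le_total ‖x - y‖ (13 * b) with hle | hle
      · refine (hnearbd hle).trans ?_
        have h1 : (‖x - y‖ ^ 2)⁻¹ = ‖x - y‖ * (‖x - y‖ ^ 3)⁻¹ := by field_simp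
        have h2 : ‖x - y‖ * (‖x - y‖ ^ 3)⁻¹ ≤ 13 * b * (‖x - y‖ ^ 3)⁻¹ := by gcongr
        have h3 : 0 ≤ 8 * |A| * (b * (‖x - y‖ ^ 3)⁻¹) := by positivity
        rw [h1]
        linarith
      · have h1 := inner_gradient_le_of_hessian_bound hD hG hH hH2 hGH hA hp hn.norm_eq hb
          (by rw [← hxp]; exact hball) hy (by rw [← hxp]; linarith)
        rw [← hxp] at h1
        rw [hval]
        refine max_le (h1.trans ?_) (by positivity)
        have h2 : 8 * A * b / ‖x - y‖ ^ 3 = 8 * A * (b * (‖x - y‖ ^ 3)⁻¹) := by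
          rw [div_eq_mul_inv]; ring
        rw [h2]
        gcongr
        linarith [le_abs_self A]

/-! ### Radial integrals and the conclusion. -/

theorem integrable_radial {g h : ℝ → ℝ} (hgh : ∀ s ∈ Set.Ioi (0 : ℝ), s ^ 2 * g s = h s)
    (hh : IntegrableOn h (Set.Ioi 0)) (x : E3) :
    Integrable (fun y : E3 => g ‖x - y‖) ∧
      ∫ y : E3, g ‖x - y‖ = 3 * (volume.real (Metric.ball (0 : E3) 1) * ∫ s in Set.Ioi 0, h s) := by
  have hdim : Module.finrank ℝ E3 = 3 := by simp
  have hcongr : Set.EqOn (fun s : ℝ => s ^ (Module.finrank ℝ E3 - 1) • g s) h (Set.Ioi 0) :=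
    fun s hs => by simpa [hdim] using hgh s hs
  constructor
  · have h1 : Integrable (fun y : E3 => g ‖y‖) :=
      (integrable_fun_norm_addHaar volume).2 (hh.congr_fun hcongr.symm measurableSet_Ioi)
    exact h1.comp_sub_left x
  · rw [integral_sub_left_eq_self (fun y : E3 => g ‖y‖) volume x,
      integral_fun_norm_addHaar volume g, setIntegral_congr_fun measurableSet_Ioi hcongr, hdim]
    simp

theorem integrable_radial_near {ρ : ℝ} (hρ : 0 ≤ ρ) (x : E3) :
    Integrable (fun y : E3 => (Set.Iic ρ).indicator (fun s => (s ^ 2)⁻¹) ‖x - y‖) ∧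
      ∫ y : E3, (Set.Iic ρ).indicator (fun s => (s ^ 2)⁻¹) ‖x - y‖
        = 3 * (volume.real (Metric.ball (0 : E3) 1) * ρ) := by
  have hint : IntegrableOn ((Set.Iic ρ).indicator (1 : ℝ → ℝ)) (Set.Ioi 0) := by
    rw [IntegrableOn, integrable_indicator_iff measurableSet_Iic, IntegrableOn,
      Measure.restrict_restrict measurableSet_Iic, Set.Iic_inter_Ioi]
    exact integrableOn_const (by simp)
  have := integrable_radial (g := (Set.Iic ρ).indicator fun s => (s ^ 2)⁻¹) (fun s hs => by
    have h0 : s ≠ 0 := ne_of_gt hs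
    by_cases h : s ∈ Set.Iic ρ
    · simp only [Set.indicator_of_mem h, Pi.one_apply]; field_simp
    · simp only [Set.indicator_of_notMem h, mul_zero]) hint x
  have hval : ∫ s in Set.Ioi 0, (Set.Iic ρ).indicator (1 : ℝ → ℝ) s = ρ := by
    rw [setIntegral_indicator measurableSet_Iic, Set.Ioi_inter_Iic]
    simp [hρ]
  rwa [hval] at this

theorem integrable_radial_annulus {ε L : ℝ} (hε : 0 < ε) (hεL : ε ≤ L) (x : E3) :
    Integrable (fun y : E3 => (Set.Ioc ε L).indicator (fun s => (s ^ 3)⁻¹) ‖x - y‖) ∧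
      ∫ y : E3, (Set.Ioc ε L).indicator (fun s => (s ^ 3)⁻¹) ‖x - y‖
        = 3 * (volume.real (Metric.ball (0 : E3) 1) * Real.log (L / ε)) := by
  have hsub : Set.Ioc ε L ∩ Set.Ioi 0 = Set.Ioc ε L :=
    Set.inter_eq_left.2 fun s hs => hε.trans hs.1
  have hcont : ContinuousOn (fun s : ℝ => s⁻¹) (Set.Icc ε L) :=
    continuousOn_inv₀.mono fun s hs => (hε.trans_le hs.1).ne'
  have hint : IntegrableOn ((Set.Ioc ε L).indicator fun s : ℝ => s⁻¹) (Set.Ioi 0) := by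
    rw [IntegrableOn, integrable_indicator_iff measurableSet_Ioc, IntegrableOn,
      Measure.restrict_restrict measurableSet_Ioc, hsub]
    exact hcont.integrableOn_Icc.mono_set Set.Ioc_subset_Icc_self
  have := integrable_radial (g := (Set.Ioc ε L).indicator fun s => (s ^ 3)⁻¹) (fun s hs => by
    have h0 : s ≠ 0 := ne_of_gt hs
    by_cases h : s ∈ Set.Ioc ε L
    · simp only [Set.indicator_of_mem h]; field_simp
    · simp only [Set.indicator_of_notMem h, mul_zero]) hint x
  have hval : ∫ s in Set.Ioi 0, (Set.Ioc ε L).indicator (fun s : ℝ => s⁻¹) s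
      = Real.log (L / ε) := by
    rw [setIntegral_indicator measurableSet_Ioc, Set.inter_comm, hsub,
      ← intervalIntegral.integral_of_le hεL, integral_inv_of_pos hε (hε.trans_le hεL)]
  rwa [hval] at this

theorem mainTheorem7 (D : Set E3) (hDopen : IsOpen D) (hDconv : Convex ℝ D)
    (hDbdry : (frontier D).Nonempty)
    (α : ℝ) (hα0 : 0 < α) (hα1 : α ≤ 1) (hDreg : IsC2HolderDomain α D)
    (G : E3 → E3 → ℝ) (hG : IsDirichletGreenFunction D G) (hGbound : GreenHessianBound D G) :
    ∃ C : ℝ, 0 < C ∧ ∀ x ∈ D, extendedDist D x ≤ 1 → DifferentiableAt ℝ (extendedDist D) x →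
      ∀ L : ℝ, 1 ≤ L →
        (MemLp (normalDerivPos D G x) 1 (volume.restrict (D ∩ {y | ‖x - y‖ ≤ L})) ∧
          eLpNorm (normalDerivPos D G x) 1 (volume.restrict (D ∩ {y | ‖x - y‖ ≤ L})) ≤
            ENNReal.ofReal (C * (extendedDist D x * Real.log (L + 1)))) ∧
        (MemLp (normalDerivPos D G x) ⊤ (volume.restrict (D ∩ {y | L ≤ ‖x - y‖})) ∧
          eLpNorm (normalDerivPos D G x) ⊤ (volume.restrict (D ∩ {y | L ≤ ‖x - y‖})) ≤
            ENNReal.ofReal (C * (extendedDist D x * L ^ (-3 : ℤ)))) := by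
  obtain ⟨C, hC, ε₀, hε₀, hmain⟩ :=
    exists_normalDerivPos_bounds hDopen hDconv hDbdry hDreg hG hGbound
  set ε : ℝ := min ε₀ 1 with hεdef
  have hε : 0 < ε := lt_min hε₀ one_pos
  have hε1 : ε ≤ 1 := min_le_right _ _
  set V : ℝ := volume.real (Metric.ball (0 : E3) 1) with hV
  have hV0 : 0 ≤ V := measureReal_nonneg
  have hlog2 : 0 < Real.log 2 := Real.log_pos (by norm_num)
  have hlogε : 0 ≤ -Real.log ε := by linarith [Real.log_nonpos hε.le hε1]
  -- Since `L ≥ 1`, `ln (L + 1) ≥ ln 2`, so the constants `13` (near region) and `-ln ε` (inner edge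
  -- of the shell) are absorbed into a multiple of `ln (L + 1)`; the final `1` handles `ln L`.
  set K : ℝ := (13 + -Real.log ε) / Real.log 2 + 1 with hK
  have hK0 : 0 ≤ K := by positivity
  refine ⟨3 * V * C * K + C, by positivity, fun x hx hx1 hdiff L hL => ?_⟩
  obtain ⟨hb, hcont, hbd⟩ := hmain x hx hdiff
  set b := extendedDist D x with hbdef
  set f := normalDerivPos D G x with hf
  have hf0 : ∀ y, 0 ≤ f y := fun y => le_max_right _ _
  have hfn : ∀ y, ‖f y‖ = f y := fun y => by rw [Real.norm_eq_abs, abs_of_nonneg (hf0 y)]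
  have hmeasD : AEStronglyMeasurable f (volume.restrict D) := by
    have h1 := hcont.aestronglyMeasurable (μ := volume)
      (hDopen.measurableSet.diff (measurableSet_singleton x))
    rwa [Measure.restrict_congr_set (sdiff_null_ae_eq_self (measure_singleton x))] at h1
  have hmeas : ∀ s : Set E3, AEStronglyMeasurable f (volume.restrict (D ∩ s)) := fun s =>
    hmeasD.mono_measure (Measure.restrict_mono Set.inter_subset_left le_rfl)
  have hxne : ∀ s : Set E3, ∀ᵐ y ∂(volume.restrict s), x ≠ y := fun s => by
    filter_upwards [ae_restrict_of_ae (Measure.ae_ne volume x)] with y hy using hy.symm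
  have hset1 : MeasurableSet (D ∩ {y | ‖x - y‖ ≤ L}) :=
    hDopen.measurableSet.inter (measurableSet_le (by fun_prop) measurable_const)
  have hset2 : MeasurableSet (D ∩ {y | L ≤ ‖x - y‖}) :=
    hDopen.measurableSet.inter (measurableSet_le measurable_const (by fun_prop))
  constructor
  · obtain ⟨i1, v1⟩ := integrable_radial_near (ρ := 13 * b) (by positivity) x
    obtain ⟨i2, v2⟩ := integrable_radial_annulus hε (hε1.trans hL) x
    set k₁ : E3 → ℝ := fun y => (Set.Iic (13 * b)).indicator (fun s => (s ^ 2)⁻¹) ‖x - y‖ with hk₁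
    set k₂ : E3 → ℝ := fun y => (Set.Ioc ε L).indicator (fun s => (s ^ 3)⁻¹) ‖x - y‖ with hk₂
    have hk₁0 : ∀ y, 0 ≤ k₁ y := fun y => Set.indicator_nonneg (fun s _ => by positivity) _
    have hk₂0 : ∀ y, 0 ≤ k₂ y := fun y => by
      simp only [hk₂, Set.indicator_apply]; split_ifs <;> positivity
    -- One integrable majorant for all three regimes; between `13 b` and `ε` it need only be
    -- nonnegative, since `f` vanishes there.
    set k : E3 → ℝ := fun y => C * (k₁ y + b * k₂ y) with hk
    have hk0 : ∀ y, 0 ≤ k y := fun y =>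
      mul_nonneg hC.le (add_nonneg (hk₁0 y) (mul_nonneg hb.le (hk₂0 y)))
    have hki : Integrable k := (i1.add (i2.const_mul b)).const_mul C
    have hle : ∀ᵐ y ∂(volume.restrict (D ∩ {y | ‖x - y‖ ≤ L})), ‖f y‖ ≤ k y := by
      filter_upwards [ae_restrict_mem hset1, hxne _] with y hy hxy
      obtain ⟨a1, a2, a3⟩ := hbd y hy.1 hxy
      rw [hfn]
      rcases le_or_gt ‖x - y‖ (13 * b) with h1 | h1
      · have e1 : k₁ y = (‖x - y‖ ^ 2)⁻¹ := Set.indicator_of_mem (Set.mem_Iic.2 h1) _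
        refine (a1 h1).trans (mul_le_mul_of_nonneg_left ?_ hC.le)
        rw [e1]
        exact le_add_of_nonneg_right (mul_nonneg hb.le (hk₂0 y))
      rcases le_or_gt ‖x - y‖ ε with h2 | h2
      · rw [a2 h1.le (h2.trans (min_le_left _ _))]
        exact hk0 y
      · have e2 : k₂ y = (‖x - y‖ ^ 3)⁻¹ := Set.indicator_of_mem (Set.mem_Ioc.2 ⟨h2, hy.2⟩) _
        refine a3.trans (mul_le_mul_of_nonneg_left ?_ hC.le)
        rw [e2]
        exact le_add_of_nonneg_left (hk₁0 y)
    have hkm : MemLp k 1 (volume.restrict (D ∩ {y | ‖x - y‖ ≤ L})) :=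
      (memLp_one_iff_integrable.2 hki).restrict _
    refine ⟨hkm.mono (hmeas _) ?_, ?_⟩
    · filter_upwards [hle] with y hy
      exact hy.trans (le_abs_self _)
    · have hint : ∫ y, k y = C * (3 * (V * (13 * b)) + b * (3 * (V * Real.log (L / ε)))) := by
        rw [hk, integral_const_mul, integral_add i1 (i2.const_mul b), integral_const_mul, v1, v2]
      have hlog : Real.log 2 ≤ Real.log (L + 1) := Real.log_le_log (by norm_num) (by linarith)
      have hbound : 13 + Real.log (L / ε) ≤ K * Real.log (L + 1) := by
        rw [Real.log_div (by linarith) hε.ne', hK, add_mul, one_mul]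
        have h1 : Real.log L ≤ Real.log (L + 1) := Real.log_le_log (by linarith) (by linarith)
        have h2 : 13 + -Real.log ε ≤ (13 + -Real.log ε) / Real.log 2 * Real.log (L + 1) := by
          rw [div_mul_eq_mul_div, le_div_iff₀ hlog2]
          gcongr
        linarith
      calc eLpNorm f 1 (volume.restrict (D ∩ {y | ‖x - y‖ ≤ L}))
          ≤ eLpNorm k 1 (volume.restrict (D ∩ {y | ‖x - y‖ ≤ L})) := eLpNorm_mono_ae (by
            filter_upwards [hle] with y hy
            exact hy.trans (le_abs_self _))
        _ ≤ eLpNorm k 1 volume := eLpNorm_restrict_le _ _ _ _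
        _ = ENNReal.ofReal (∫ y, k y) := by
            rw [eLpNorm_one_eq_lintegral_enorm,
              ofReal_integral_eq_lintegral_ofReal hki (Eventually.of_forall hk0)]
            exact lintegral_congr fun y => Real.enorm_eq_ofReal (hk0 y)
        _ ≤ _ := by
            refine ENNReal.ofReal_le_ofReal ?_
            rw [hint]
            have h1 := mul_le_mul_of_nonneg_left hbound (by positivity : 0 ≤ 3 * V * C * b)
            have h2 : 0 ≤ C * (b * Real.log (L + 1)) :=
              mul_nonneg hC.le (mul_nonneg hb.le (hlog2.le.trans hlog))
            calc _ = 3 * V * C * b * (13 + Real.log (L / ε)) := by ring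
              _ ≤ 3 * V * C * b * (K * Real.log (L + 1)) + C * (b * Real.log (L + 1)) := by
                linarith
              _ = _ := by ring
  · have hle : ∀ᵐ y ∂(volume.restrict (D ∩ {y | L ≤ ‖x - y‖})),
        ‖f y‖ ≤ (3 * V * C * K + C) * (b * L ^ (-3 : ℤ)) := by
      filter_upwards [ae_restrict_mem hset2, hxne _] with y hy hxy
      obtain ⟨-, -, a3⟩ := hbd y hy.1 hxy
      rw [hfn]
      refine a3.trans ?_
      have hL0 : 0 < L := by linarith
      have hL3 : L ^ (-3 : ℤ) = (L ^ 3)⁻¹ := by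
        rw [zpow_neg]; norm_cast
      have hyL : L ≤ ‖x - y‖ := hy.2
      rw [hL3]
      gcongr
      exact le_add_of_nonneg_left (by positivity)
    refine ⟨memLp_top_of_bound (hmeas _) _ hle, ?_⟩
    rw [eLpNorm_exponent_top]
    exact eLpNormEssSup_le_of_ae_bound hle
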